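/- Let $\Omega\subseteq\mathbb C$ be open, let $\overline\Omega$ be its closure in $\mathbb C$, and suppose that $(\mathbb C\cup\{\infty\})\setminus\overline\Omega$ is connected. Let $A^\infty(\Omega)$ be the space of holomorphic functions $f$ on $\Omega$ such that every derivative $f^{(\ell)}$, $\ell=0,1,2,\dots$, extends continuously to $\overline\Omega$ (the extension is again denoted by $f^{(\ell)}$), with the topology of uniform convergence of all derivatives on every compact subset of $\overline\Omega$. Let $X^\infty$ be the closure in $A^\infty(\Omega)$ of the set of functions that are holomorphic on some open set (depending on the function) containing $\overline\Omega$. Let $\mathcal F\subseteq\mathbb N\times\mathbb N$ (with $0\in\mathbb N$) contain a sequence $(\tilde p_n,\tilde q_n)$ with $\tilde p_n\to+\infty$. For $f\in A^\infty(\Omega)$, $\zeta\in\overline\Omega$ put $a_v=f^{(v)}(\zeta)/v!$ for $v\ge 0$ and $a_v=0$ for $v<0$. Write $f\in\mathcal D_{p,q}(\zeta)$ if $\det(a_{p-q+1+i+j})_{0\le i,j<q}\neq 0$ (no condition if $q=0$). A Padé approximant $[p/q]_{f,\zeta}$ is a rational function of the form $\sum_{v=0}^p n_v(z-\zeta)^v\big/\sum_{v=0}^q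 d_v(z-\zeta)^v$ with $d_0=1$ whose Taylor coefficients at $\zeta$ of orders $0,\dots,p+q$ are $a_0,\dots,a_{p+q}$. **Theorem 4.7.** The set of all $f\in X^\infty$ with the following property is a dense $G_\delta$ subset of $X^\infty$: there is a sequence $(p_n,q_n)_{n\in\mathbb N}$ in $\mathcal F$ such that for every compact set $K\subseteq\overline\Omega$ there is $n(K)\in\mathbb N$ so that, for all $n\ge n(K)$ and all $\zeta\in K$, we have $f\in\mathcal D_{p_n,q_n}(\zeta)$, the Padé approximant $[p_n/q_n]_{f,\zeta}$ exists, is unique and has no poles in $K$; and, for every $\ell=0,1,2,\dots$, $$\sup_{\zeta\in K}\sup_{z\in K}\bigl|[p_n/q_n]^{(\ell)}_{f,\zeta}(z)-f^{(\ell)}(z)\bigr|\to 0\qquad(n\to+\infty).$$ -/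

import Mathlib

open Filter Topology Polynomial

/-- `f = (f 0, f 1, f 2, …)` is the sequence of the continuous extensions to the closure of `Ω`
(in the plane) of all derivatives `F, F', F'', …` of a function `F` holomorphic on `Ω`. -/
def IsDerivativeSequence (Ω : Set ℂ) (f : ℕ → C(closure Ω, ℂ)) : Prop :=
  ∃ F : ℂ → ℂ, DifferentiableOn ℂ F Ω ∧
    ∀ (l : ℕ) (z : closure Ω), (z : ℂ) ∈ Ω → f l z = iteratedDeriv l F z

/-- The space `A^∞(Ω)` of the holomorphic functions on `Ω` all of whose derivatives extend
continuously to the closure of `Ω`. Such a function is recorded together with the (unique)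
extensions of its derivatives; it is determined by its values on `Ω`, see `AInfty.ext_on`.
The topology is the one induced by the product over `l` of the compact-open topologies, that is,
uniform convergence of every derivative on every compact subset of the closure of `Ω`. -/
abbrev AInfty (Ω : Set ℂ) : Type :=
  {f : ℕ → C(closure Ω, ℂ) // IsDerivativeSequence Ω f}

/-- The continuous extension to the closure of `Ω` of the `l`-th derivative of `f`. -/
def AInfty.derivExt {Ω : Set ℂ} (f : AInfty Ω) (l : ℕ) : C(closure Ω, ℂ) := f.1 l

/-- Two elements of `A^∞(Ω)` that agree on the open set `Ω` are equal. -/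
theorem AInfty.ext_on {Ω : Set ℂ} (hΩ : IsOpen Ω) (f g : AInfty Ω)
    (h : ∀ z : closure Ω, (z : ℂ) ∈ Ω → f.derivExt 0 z = g.derivExt 0 z) : f = g := by
  obtain ⟨F, -, hF⟩ := f.2
  obtain ⟨G, -, hG⟩ := g.2
  have hFG : Set.EqOn F G Ω := by
    intro z hz
    have h1 := h ⟨z, subset_closure hz⟩ hz
    simp only [AInfty.derivExt, hF 0 ⟨z, subset_closure hz⟩ hz,
      hG 0 ⟨z, subset_closure hz⟩ hz, iteratedDeriv_zero] at h1
    exact h1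
  have hd : Dense {z : closure Ω | (z : ℂ) ∈ Ω} := by
    intro z
    rw [closure_subtype]
    have : Subtype.val '' {z : closure Ω | (z : ℂ) ∈ Ω} = Ω := by
      ext w
      constructor
      · rintro ⟨v, hv, rfl⟩
        exact hv
      · intro hw
        exact ⟨⟨w, subset_closure hw⟩, hw, rfl⟩
    rw [this]
    exact z.2
  apply Subtype.ext
  funext l
  apply ContinuousMap.coe_injective
  refine Continuous.ext_on hd (f.1 l).continuous (g.1 l).continuous ?_
  intro z hz
  rw [hF l z hz, hG l z hz]
  exact Filter.EventuallyEq.iteratedDeriv_eq l (hFG.eventuallyEq_of_mem (hΩ.mem_nhds hz))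

/-- The functions in `A^∞(Ω)` that come from a function holomorphic on some open set (depending
on the function) containing the closure of `Ω`. -/
def holomorphicNearClosure (Ω : Set ℂ) : Set (AInfty Ω) :=
  {f | ∃ (U : Set ℂ) (F : ℂ → ℂ), IsOpen U ∧ closure Ω ⊆ U ∧ DifferentiableOn ℂ F U ∧
    ∀ z : closure Ω, f.derivExt 0 z = F z}

/-- The space `X^∞`: the closure in `A^∞(Ω)` of the functions holomorphic near the closure
of `Ω`. It carries the subspace topology. -/
def XInfty (Ω : Set ℂ) : Set (AInfty Ω) := closure (holomorphicNearClosure Ω)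

/-- The coefficient `f^(v)(ζ) / v!`, for `ζ` in the closure of `Ω`. -/
noncomputable def AInfty.taylorCoeff {Ω : Set ℂ} (f : AInfty Ω) (ζ : closure Ω) (v : ℕ) : ℂ :=
  f.derivExt v ζ / (v.factorial : ℂ)

/-- The `q × q` Hankel determinant with entries `a_(p-q+1+i+j)`, `0 ≤ i, j < q`, where `a_k = 0`
for negative `k`. For `q = 0` it is `1`. -/
noncomputable def hankelDet (a : ℕ → ℂ) (p q : ℕ) : ℂ :=
  Matrix.det (Matrix.of fun i j : Fin q =>
    if 0 ≤ (p : ℤ) - q + 1 + i + j then a ((p : ℤ) - q + 1 + i + j).toNat else 0)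

/-- The rational function `R` (in the variable `X = z - ζ`) is a Padé approximant of type `[p/q]`
of the formal series `∑ a_v X ^ v`: it is a quotient `N / D` of polynomials of degrees at most `p`
and `q`, with `D(0) = 1`, whose Taylor series has the coefficients `a_v` for `v ≤ p + q`. -/
def IsPadeApproximant (a : ℕ → ℂ) (p q : ℕ) (R : RatFunc ℂ) : Prop :=
  ∃ N D : ℂ[X], N.natDegree ≤ p ∧ D.natDegree ≤ q ∧ D.coeff 0 = 1 ∧
    R = algebraMap ℂ[X] (RatFunc ℂ) N / algebraMap ℂ[X] (RatFunc ℂ) D ∧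
    ∀ v ≤ p + q, PowerSeries.coeff v ((N : PowerSeries ℂ) * (D : PowerSeries ℂ)⁻¹) = a v

open Classical in
/-- The `[p/q]` Padé approximant of the series `∑ a_v X ^ v` (and `0` if there is none). -/
noncomputable def padeApproximant (a : ℕ → ℂ) (p q : ℕ) : RatFunc ℂ :=
  if h : ∃ R, IsPadeApproximant a p q R then h.choose else 0

/-- The `[p/q]` Padé approximant of `f` with centre `ζ`, as a function of `z`, away from its
poles. -/
noncomputable def AInfty.padeAt {Ω : Set ℂ} (f : AInfty Ω) (p q : ℕ) (ζ : closure Ω) (z : ℂ) : ℂ :=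
  (padeApproximant (f.taylorCoeff ζ) p q).eval (RingHom.id ℂ) (z - ζ)

/-- The `[p/q]` Padé approximant of `f` with centre `ζ` has a pole at `z`, i.e. the denominator in
lowest terms vanishes there. -/
def AInfty.HasPadePole {Ω : Set ℂ} (f : AInfty Ω) (p q : ℕ) (ζ : closure Ω) (z : ℂ) : Prop :=
  (padeApproximant (f.taylorCoeff ζ) p q).denom.eval (z - ζ) = 0

/-- There is a sequence `(p_n, q_n)` in `𝓕` such that for every compact subset `K` of the closure
of `Ω`: for all large `n`, at every centre `ζ ∈ K` the Hankel determinant of `f` is nonzero, the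
Padé approximant exists, is unique, and has no poles in `K`; and every derivative of the Padé
approximants converges to that of `f`, uniformly in `(ζ, z) ∈ K × K`. -/
def HasPadeApproximation {Ω : Set ℂ} (𝓕 : Set (ℕ × ℕ)) (f : AInfty Ω) : Prop :=
  ∃ p q : ℕ → ℕ, (∀ n, (p n, q n) ∈ 𝓕) ∧
    ∀ K : Set (closure Ω), IsCompact K →
      (∃ n₀ : ℕ, ∀ n ≥ n₀, ∀ ζ ∈ K,
        hankelDet (f.taylorCoeff ζ) (p n) (q n) ≠ 0 ∧
        (∃! R, IsPadeApproximant (f.taylorCoeff ζ) (p n) (q n) R) ∧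
        ∀ z ∈ K, ¬ f.HasPadePole (p n) (q n) ζ z) ∧
      ∀ l : ℕ, TendstoUniformlyOn
        (fun n (x : closure Ω × closure Ω) => iteratedDeriv l (f.padeAt (p n) (q n) x.1) x.2)
        (fun x => f.derivExt l x.2) atTop (K ×ˢ K)

/-! The proof is a Baire category argument. For each `n`, let `E n` be the set of `f` for which a
single pair of `𝓕` is good at level `n`: for all centres and points in the part of the closure of
`Ω` of modulus at most `n`, the Hankel determinant is nonzero, there is no pole, and the derivatives
up to order `n` are approximated within `1 / (n + 1)`. By a diagonal choice of pairs, the required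
property is membership in every `E n` (`hasPadeApproximation_iff`). Since `X^∞` is a Baire space
(`baireSpace_XInfty`), it suffices that the trace of each `E n` on `X^∞` is open and dense.

Openness: when the Hankel determinant is nonzero, Cramer's rule gives a numerator and a denominator
whose coefficients are polynomials in the Taylor coefficients; they are coprime, so they show the
true values and poles. After clearing denominators, the conditions are strict inequalities between
continuous functions of `f`, the centre and the point (`AInfty.isOpen_isPadeClose`), and compactness
makes them uniform.

Density: a polynomial of exact degree `p` is its own `[p/q]` approximant at every centre, for every
`q` (`AInfty.isPadeClose_ofPolynomial`). Any polynomial `P` is the limit, as `c → 0`, of `P + c X ^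
p` with `p > deg P`, and `𝓕` contains pairs with `p` as large as desired. So it remains to see that
polynomials are dense in `X^∞`.

That is Runge's theorem with derivatives (`runge_iteratedDeriv`). The Cauchy-Pompeiu formula writes
a function holomorphic near a compact `K` as a superposition of `1 / (z - w)` with poles off `K`;
connectedness of the complement in the sphere allows these poles to be pushed to infinity.
Approximation on a closed neighbourhood of `K`, not only on `K`, gives the derivatives by Cauchy's
estimates. -/

/-! ### Linear algebra of Padé approximants -/

/-- The Hankel matrix whose determinant is `hankelDet a p q`. -/
noncomputable def hankelMatrix (a : ℕ → ℂ) (p q : ℕ) : Matrix (Fin q) (Fin q) ℂ :=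
  Matrix.of fun i j : Fin q =>
    if 0 ≤ (p : ℤ) - q + 1 + i + j then a ((p : ℤ) - q + 1 + i + j).toNat else 0

theorem hankelDet_eq (a : ℕ → ℂ) (p q : ℕ) : hankelDet a p q = (hankelMatrix a p q).det := rfl

/-- The coefficients of `D * ∑ a_v X ^ v` just above the order `p`. -/
theorem coeff_mul_mk_eq_hankelMatrix_mulVec (a : ℕ → ℂ) (p q : ℕ) (D : ℂ[X])
    (hD : D.natDegree ≤ q) (i : Fin q) :
    PowerSeries.coeff (p + 1 + i) ((D : PowerSeries ℂ) * PowerSeries.mk a) =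
      D.coeff 0 * a (p + 1 + i) +
        (hankelMatrix a p q).mulVec (fun j => D.coeff (q - j)) i := by
  have h1 : PowerSeries.coeff (p + 1 + i) ((D : PowerSeries ℂ) * PowerSeries.mk a) =
      ∑ k ∈ Finset.range (q + 1),
        D.coeff k * (if k ≤ p + 1 + i then a (p + 1 + i - k) else 0) := by
    conv_lhs => rw [D.as_sum_range' (q + 1) (Nat.lt_succ_of_le hD)]
    rw [← Polynomial.coeToPowerSeries.ringHom_apply, map_sum, Finset.sum_mul, map_sum]
    refine Finset.sum_congr rfl fun k _ => ?_
    rw [Polynomial.coeToPowerSeries.ringHom_apply, ← C_mul_X_pow_eq_monomial,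
      Polynomial.coe_mul, Polynomial.coe_C, Polynomial.coe_pow, Polynomial.coe_X, mul_assoc,
      PowerSeries.coeff_C_mul, PowerSeries.coeff_X_pow_mul']
    simp
  rw [h1, Finset.sum_range_succ', add_comm]
  congr 1
  rw [Matrix.mulVec, dotProduct, ← Finset.sum_range_reflect, Finset.sum_range]
  refine Finset.sum_congr rfl fun j _ => ?_
  have hj := j.2
  have e : q - 1 - (j : ℕ) + 1 = q - j := by omega
  rw [e, mul_comm]
  congr 1
  simp only [hankelMatrix, Matrix.of_apply]
  by_cases h : q - (j : ℕ) ≤ p + 1 + i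
  · rw [if_pos h, if_pos (by omega)]
    congr 1
    omega
  · rw [if_neg h, if_neg (by omega)]

/-- The Padé denominator, normalized to be polynomial in the coefficients of the series. -/
noncomputable def padeDenom (a : ℕ → ℂ) (p q : ℕ) : ℂ[X] :=
  C (hankelDet a p q) + ∑ j : Fin q,
    C ((hankelMatrix a p q).adjugate.mulVec (fun i : Fin q => -a (p + 1 + i)) j) *
      X ^ (q - (j : ℕ))

/-- The Padé numerator that belongs to `padeDenom`. -/
noncomputable def padeNum (a : ℕ → ℂ) (p q : ℕ) : ℂ[X] :=
  PowerSeries.trunc (p + 1) ((padeDenom a p q : PowerSeries ℂ) * PowerSeries.mk a)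

theorem padeDenom_natDegree_le (a : ℕ → ℂ) (p q : ℕ) : (padeDenom a p q).natDegree ≤ q := by
  refine (natDegree_add_le _ _).trans (max_le (by simp) ?_)
  refine natDegree_sum_le_of_forall_le _ _ fun j _ => ?_
  exact (natDegree_C_mul_X_pow_le _ _).trans (Nat.sub_le _ _)

theorem padeNum_natDegree_le (a : ℕ → ℂ) (p q : ℕ) : (padeNum a p q).natDegree ≤ p :=
  Nat.lt_succ_iff.1 (PowerSeries.natDegree_trunc_lt _ _)

theorem padeDenom_coeff_zero (a : ℕ → ℂ) (p q : ℕ) :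
    (padeDenom a p q).coeff 0 = hankelDet a p q := by
  simp only [padeDenom, coeff_add, coeff_C_zero, finsetSum_coeff, coeff_C_mul_X_pow]
  rw [Finset.sum_eq_zero, add_zero]
  intro j _
  rw [if_neg]
  have := j.2
  omega

theorem padeDenom_coeff_sub (a : ℕ → ℂ) (p q : ℕ) (j : Fin q) :
    (padeDenom a p q).coeff (q - j) =
      (hankelMatrix a p q).adjugate.mulVec (fun i : Fin q => -a (p + 1 + i)) j := by
  have hj := j.2
  simp only [padeDenom, coeff_add, finsetSum_coeff, coeff_C_mul_X_pow]
  rw [coeff_C_of_ne_zero (by omega), zero_add, Finset.sum_eq_single j]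
  · simp
  · intro b _ hb
    rw [if_neg]
    have := b.2
    intro h
    exact hb (Fin.ext (by omega))
  · simp

/-- Orders up to `p` agree by truncation. Orders `p + 1, …, p + q` form the Hankel linear system,
which the adjugate solves by Cramer's rule. No determinant has to be nonzero here, as nothing is
divided. -/
theorem X_pow_dvd_pade (a : ℕ → ℂ) (p q : ℕ) :
    (PowerSeries.X : PowerSeries ℂ) ^ (p + q + 1) ∣
      (padeNum a p q : PowerSeries ℂ) - (padeDenom a p q : PowerSeries ℂ) * PowerSeries.mk a := by
  rw [PowerSeries.X_pow_dvd_iff]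
  intro m hm
  rw [map_sub, Polynomial.coeff_coe, padeNum, PowerSeries.coeff_trunc]
  split_ifs with h
  · exact sub_self _
  · obtain ⟨i, rfl⟩ : ∃ i : Fin q, m = p + 1 + i := ⟨⟨m - (p + 1), by omega⟩, by simp; omega⟩
    rw [coeff_mul_mk_eq_hankelMatrix_mulVec a p q _ (padeDenom_natDegree_le a p q)]
    have e : (fun j : Fin q => (padeDenom a p q).coeff (q - j)) =
        (hankelMatrix a p q).adjugate.mulVec (fun i : Fin q => -a (p + 1 + i)) :=
      funext fun j => padeDenom_coeff_sub a p q j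
    rw [e, padeDenom_coeff_zero, hankelDet_eq, Matrix.mulVec_mulVec, Matrix.mul_adjugate, Matrix.smul_mulVec, Matrix.one_mulVec]
    simp

/-- If the Hankel determinant does not vanish, the homogeneous Padé problem has no nontrivial
solution whose denominator vanishes at `0`. -/
theorem eq_zero_of_X_pow_dvd {a : ℕ → ℂ} {p q : ℕ} (h : hankelDet a p q ≠ 0) {N D : ℂ[X]}
    (hN : N.natDegree ≤ p) (hD : D.natDegree ≤ q) (h0 : D.coeff 0 = 0)
    (hd : (PowerSeries.X : PowerSeries ℂ) ^ (p + q + 1) ∣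
      (N : PowerSeries ℂ) - (D : PowerSeries ℂ) * PowerSeries.mk a) : N = 0 ∧ D = 0 := by
  rw [PowerSeries.X_pow_dvd_iff] at hd
  have hv : (hankelMatrix a p q).mulVec (fun j => D.coeff (q - j)) = 0 := by
    funext i
    have := hd (p + 1 + i) (by omega)
    rw [map_sub, coeff_mul_mk_eq_hankelMatrix_mulVec a p q D hD, Polynomial.coeff_coe,
      coeff_eq_zero_of_natDegree_lt (by omega), h0] at this
    simpa using this
  have hx := Matrix.eq_zero_of_mulVec_eq_zero h hv
  have hD0 : D = 0 := by
    ext k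
    rw [coeff_zero]
    rcases Nat.eq_zero_or_pos k with rfl | hk
    · exact h0
    by_cases hkq : k ≤ q
    · have := congrFun hx ⟨q - k, by omega⟩
      simpa [Nat.sub_sub_self hkq] using this
    · exact coeff_eq_zero_of_natDegree_lt (by omega)
  refine ⟨?_, hD0⟩
  ext k
  rw [coeff_zero]
  by_cases hk : k ≤ p
  · have := hd k (by omega)
    simpa [hD0] using this
  · exact coeff_eq_zero_of_natDegree_lt (by omega)

/-- Linearizes the Padé condition: the denominator is a unit among the power series, so multiplying
by it does not change the order of vanishing. -/
theorem coeff_mul_inv_eq_iff (a : ℕ → ℂ) (m : ℕ) (N D : ℂ[X]) (h0 : D.coeff 0 ≠ 0) :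
    (∀ v ≤ m, PowerSeries.coeff v ((N : PowerSeries ℂ) * (D : PowerSeries ℂ)⁻¹) = a v) ↔
      (PowerSeries.X : PowerSeries ℂ) ^ (m + 1) ∣
        (N : PowerSeries ℂ) - (D : PowerSeries ℂ) * PowerSeries.mk a := by
  have hD : PowerSeries.constantCoeff (D : PowerSeries ℂ) ≠ 0 := by
    rwa [Polynomial.constantCoeff_coe]
  have key : (N : PowerSeries ℂ) * (D : PowerSeries ℂ)⁻¹ - PowerSeries.mk a =
      ((N : PowerSeries ℂ) - (D : PowerSeries ℂ) * PowerSeries.mk a) *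
        (D : PowerSeries ℂ)⁻¹ := by
    rw [sub_mul, mul_right_comm, PowerSeries.mul_inv_cancel _ hD, one_mul]
  have hu : IsUnit (D : PowerSeries ℂ)⁻¹ :=
    IsUnit.of_mul_eq_one (D : PowerSeries ℂ) (PowerSeries.inv_mul_cancel _ hD)
  rw [← hu.dvd_mul_right, ← key, PowerSeries.X_pow_dvd_iff]
  simp only [map_sub, PowerSeries.coeff_mk, sub_eq_zero, Nat.lt_succ_iff]

theorem isPadeApproximant_iff (a : ℕ → ℂ) (p q : ℕ) (R : RatFunc ℂ) :
    IsPadeApproximant a p q R ↔ ∃ N D : ℂ[X], N.natDegree ≤ p ∧ D.natDegree ≤ q ∧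
      D.coeff 0 = 1 ∧ R = algebraMap ℂ[X] (RatFunc ℂ) N / algebraMap ℂ[X] (RatFunc ℂ) D ∧
      (PowerSeries.X : PowerSeries ℂ) ^ (p + q + 1) ∣
        (N : PowerSeries ℂ) - (D : PowerSeries ℂ) * PowerSeries.mk a := by
  refine exists_congr fun N => exists_congr fun D => and_congr_right fun _ =>
    and_congr_right fun _ => and_congr_right fun h => and_congr_right fun _ => ?_
  exact coeff_mul_inv_eq_iff a (p + q) N D (by simp [h])

theorem isPadeApproximant_pade {a : ℕ → ℂ} {p q : ℕ} (h : hankelDet a p q ≠ 0) :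
    IsPadeApproximant a p q (algebraMap ℂ[X] (RatFunc ℂ) (padeNum a p q) /
      algebraMap ℂ[X] (RatFunc ℂ) (padeDenom a p q)) := by
  rw [isPadeApproximant_iff]
  have hc : (hankelDet a p q)⁻¹ ≠ 0 := inv_ne_zero h
  refine ⟨C (hankelDet a p q)⁻¹ * padeNum a p q, C (hankelDet a p q)⁻¹ * padeDenom a p q,
    (natDegree_C_mul_le _ _).trans (padeNum_natDegree_le a p q),
    (natDegree_C_mul_le _ _).trans (padeDenom_natDegree_le a p q), ?_, ?_, ?_⟩
  · rw [coeff_C_mul, padeDenom_coeff_zero, inv_mul_cancel₀ h]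
  · rw [map_mul, map_mul, mul_div_mul_left]
    simpa using h
  · rw [Polynomial.coe_mul, Polynomial.coe_mul, mul_assoc, ← mul_sub]
    exact (X_pow_dvd_pade a p q).mul_left _

/-- The difference of two normalized solutions solves the homogeneous problem with a denominator
vanishing at `0`, hence is trivial. -/
theorem isPadeApproximant_unique {a : ℕ → ℂ} {p q : ℕ} (h : hankelDet a p q ≠ 0)
    {R S : RatFunc ℂ} (hR : IsPadeApproximant a p q R) (hS : IsPadeApproximant a p q S) :
    R = S := by
  rw [isPadeApproximant_iff] at hR hS
  obtain ⟨N, D, hN, hD, h1, rfl, hd⟩ := hR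
  obtain ⟨N', D', hN', hD', h1', rfl, hd'⟩ := hS
  have key := eq_zero_of_X_pow_dvd (N := N - N') (D := D - D') h
    ((natDegree_sub_le _ _).trans (max_le hN hN')) ((natDegree_sub_le _ _).trans (max_le hD hD'))
    (by simp [h1, h1']) (by
      have := dvd_sub hd hd'
      convert this using 1
      rw [Polynomial.coe_sub, Polynomial.coe_sub]
      ring)
  rw [sub_eq_zero.1 key.1, sub_eq_zero.1 key.2]

theorem existsUnique_isPadeApproximant {a : ℕ → ℂ} {p q : ℕ} (h : hankelDet a p q ≠ 0) :
    ∃! R, IsPadeApproximant a p q R :=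
  ⟨_, isPadeApproximant_pade h, fun _ hS => isPadeApproximant_unique h hS
    (isPadeApproximant_pade h)⟩

theorem padeApproximant_eq {a : ℕ → ℂ} {p q : ℕ} (h : hankelDet a p q ≠ 0) {R : RatFunc ℂ}
    (hR : IsPadeApproximant a p q R) : padeApproximant a p q = R := by
  have hex : ∃ R, IsPadeApproximant a p q R := ⟨R, hR⟩
  rw [padeApproximant, dif_pos hex]
  exact isPadeApproximant_unique h hex.choose_spec hR

/-- A common factor `g` has `g(0) ≠ 0`, so the cofactors still satisfy the order condition.
Multiplying them by `g - g(0)` in place of `g` respects the degree bounds and makes the denominator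
vanish at `0`; `eq_zero_of_X_pow_dvd` then forces `g = g(0)`. Coprimality ensures that the zeros of
`padeDenom` are exactly the poles. -/
theorem isCoprime_pade {a : ℕ → ℂ} {p q : ℕ} (h : hankelDet a p q ≠ 0) :
    IsCoprime (padeNum a p q) (padeDenom a p q) := by
  have hD0 : padeDenom a p q ≠ 0 := by
    intro h0
    apply h
    rw [← padeDenom_coeff_zero, h0, coeff_zero]
  rw [← EuclideanDomain.gcd_isUnit_iff]
  obtain ⟨N', hN'⟩ := EuclideanDomain.gcd_dvd_left (padeNum a p q) (padeDenom a p q)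
  obtain ⟨D', hD'⟩ := EuclideanDomain.gcd_dvd_right (padeNum a p q) (padeDenom a p q)
  set g := EuclideanDomain.gcd (padeNum a p q) (padeDenom a p q)
  have hD'0 : D' ≠ 0 := by
    rintro rfl
    exact hD0 (by rw [hD', mul_zero])
  have hg0 : g ≠ 0 := by
    intro hg
    exact hD0 (by rw [hD', hg, zero_mul])
  have hgc : g.coeff 0 ≠ 0 := by
    intro hg
    apply h
    rw [← padeDenom_coeff_zero, hD', mul_coeff_zero, hg, zero_mul]
  have hgu : IsUnit (g : PowerSeries ℂ) := by
    rw [PowerSeries.isUnit_iff_constantCoeff, Polynomial.constantCoeff_coe]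
    exact hgc.isUnit
  have hdvd : (PowerSeries.X : PowerSeries ℂ) ^ (p + q + 1) ∣
      (N' : PowerSeries ℂ) - (D' : PowerSeries ℂ) * PowerSeries.mk a := by
    rw [← hgu.dvd_mul_left, mul_sub, ← mul_assoc, ← Polynomial.coe_mul, ← Polynomial.coe_mul,
      ← hN', ← hD']
    exact X_pow_dvd_pade a p q
  have hle : ∀ {M M' : ℂ[X]}, M = g * M' → ((g - C (g.coeff 0)) * M').natDegree ≤ M.natDegree := by
    rintro M M' rfl
    rcases eq_or_ne M' 0 with rfl | hM
    · simp
    rw [natDegree_mul hg0 hM]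
    exact natDegree_mul_le.trans (Nat.add_le_add_right (natDegree_sub_C.le) _)
  have key := eq_zero_of_X_pow_dvd (N := (g - C (g.coeff 0)) * N')
    (D := (g - C (g.coeff 0)) * D') h ((hle hN').trans (padeNum_natDegree_le a p q))
    ((hle hD').trans (padeDenom_natDegree_le a p q)) (by simp [mul_coeff_zero]) (by
      rw [Polynomial.coe_mul, Polynomial.coe_mul, mul_assoc, ← mul_sub]
      exact hdvd.mul_left _)
  have hgC : g = C (g.coeff 0) := by
    rcases mul_eq_zero.1 key.2 with h1 | h1
    · exact sub_eq_zero.1 h1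
    · exact absurd h1 hD'0
  rw [hgC, isUnit_C]
  exact hgc.isUnit

theorem ratFunc_num_denom_of_isCoprime {N D : ℂ[X]} (hD : D ≠ 0) (h : IsCoprime N D) :
    ∃ c : ℂ, c ≠ 0 ∧
      N = C c * (algebraMap ℂ[X] (RatFunc ℂ) N / algebraMap ℂ[X] (RatFunc ℂ) D).num ∧
      D = C c * (algebraMap ℂ[X] (RatFunc ℂ) N / algebraMap ℂ[X] (RatFunc ℂ) D).denom := by
  set R := algebraMap ℂ[X] (RatFunc ℂ) N / algebraMap ℂ[X] (RatFunc ℂ) D with hR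
  have e : R.num * D = N * R.denom := (RatFunc.num_mul_eq_mul_denom_iff hD).2 rfl
  have h1 : D ∣ R.denom := h.symm.dvd_of_dvd_mul_left ⟨R.num, by rw [← e, mul_comm]⟩
  have h2 : R.denom ∣ D := (RatFunc.isCoprime_num_denom R).symm.dvd_of_dvd_mul_left
    ⟨N, by rw [e, mul_comm]⟩
  obtain ⟨u, hu⟩ := associated_of_dvd_dvd h2 h1
  obtain ⟨c, hc, hcu⟩ := Polynomial.isUnit_iff.1 u.isUnit
  refine ⟨c, hc.ne_zero, ?_, ?_⟩
  · have h3 : R.denom ≠ 0 := RatFunc.denom_ne_zero R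
    apply mul_right_cancel₀ h3
    rw [← e, ← hu, ← hcu]
    ring
  · rw [hcu, mul_comm, hu]

theorem padeApproximant_eval {a : ℕ → ℂ} {p q : ℕ} (h : hankelDet a p q ≠ 0) (x : ℂ) :
    (padeApproximant a p q).eval (RingHom.id ℂ) x =
      (padeNum a p q).eval x / (padeDenom a p q).eval x := by
  have hD0 : padeDenom a p q ≠ 0 := by
    intro h0
    apply h
    rw [← padeDenom_coeff_zero, h0, coeff_zero]
  obtain ⟨c, hc, hN, hD⟩ := ratFunc_num_denom_of_isCoprime hD0 (isCoprime_pade h)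
  rw [padeApproximant_eq h (isPadeApproximant_pade h), RatFunc.eval, eval₂_id, eval₂_id]
  have e1 := congrArg (eval x) hN
  have e2 := congrArg (eval x) hD
  rw [eval_mul, eval_C] at e1 e2
  rw [e1, e2, mul_div_mul_left _ _ hc]

theorem padeApproximant_denom_eval_eq_zero_iff {a : ℕ → ℂ} {p q : ℕ} (h : hankelDet a p q ≠ 0)
    (x : ℂ) : (padeApproximant a p q).denom.eval x = 0 ↔ (padeDenom a p q).eval x = 0 := by
  have hD0 : padeDenom a p q ≠ 0 := by
    intro h0
    apply h
    rw [← padeDenom_coeff_zero, h0, coeff_zero]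
  obtain ⟨c, hc, hN, hD⟩ := ratFunc_num_denom_of_isCoprime hD0 (isCoprime_pade h)
  rw [padeApproximant_eq h (isPadeApproximant_pade h)]
  have e2 := congrArg (eval x) hD
  rw [eval_mul, eval_C] at e2
  rw [e2, mul_eq_zero, or_iff_right hc]

/-- For a polynomial of exact degree `p`, the Hankel determinant is nonzero. -/
theorem hankelDet_ne_zero_of_vanish {a : ℕ → ℂ} {p : ℕ} (q : ℕ) (hp : a p ≠ 0)
    (h : ∀ v, p < v → a v = 0) : hankelDet a p q ≠ 0 := by
  rw [hankelDet_eq]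
  intro h0
  obtain ⟨w, hw, hw0⟩ := Matrix.exists_vecMul_eq_zero_iff.2 h0
  apply hw
  have key : ∀ n : ℕ, ∀ i : Fin q, (i : ℕ) = n → w i = 0 := by
    intro n
    induction n using Nat.strong_induction_on with
    | _ n ih =>
      intro i hi
      -- The matrix is triangular about its antidiagonal, where every entry is `a p`. In column `q -
      -- 1 - n`, rows below `n` contribute zero because the entries have index greater than `p`, and
      -- rows above `n` by induction.
      have := congrFun hw0 ⟨q - 1 - n, by omega⟩
      rw [Matrix.vecMul, dotProduct, Finset.sum_eq_single i] at this
      · simp only [hankelMatrix, Matrix.of_apply] at this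
        have hi2 := i.2
        have e : (p : ℤ) - q + 1 + (i : ℕ) + ((q - 1 - n : ℕ) : ℤ) = p := by omega
        rw [e, if_pos (by omega), Int.toNat_natCast] at this
        simpa [hp] using this
      · intro b _ hb
        have hi2 := i.2
        rcases lt_or_ge (b : ℕ) n with hbn | hbn
        · rw [ih b hbn b rfl, zero_mul]
        · have hbn' : n < (b : ℕ) := by
            rcases hbn.lt_or_eq with h1 | h1
            · exact h1
            · exact absurd (Fin.ext (by omega)) hb
          simp only [hankelMatrix, Matrix.of_apply]
          rw [if_pos (by omega), h _ (by omega), mul_zero]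
      · simp
  funext i
  exact key i i rfl

/-! ### Uniform polynomial approximation and pole pushing -/

/-- The function `f` is a uniform limit of polynomials on `s`. -/
def PolynomialApproximable (s : Set ℂ) (f : ℂ → ℂ) : Prop :=
  ∀ ε > 0, ∃ P : ℂ[X], ∀ z ∈ s, ‖P.eval z - f z‖ < ε

theorem PolynomialApproximable.mono {s t : Set ℂ} {f : ℂ → ℂ} (h : PolynomialApproximable t f)
    (hst : s ⊆ t) : PolynomialApproximable s f := fun ε hε =>
  let ⟨P, hP⟩ := h ε hε
  ⟨P, fun z hz => hP z (hst hz)⟩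

/-- Passes to a closed subalgebra, so that products, series and integrals of approximable functions
are available. -/
theorem mem_closure_polynomialFunctions_iff {s : Set ℂ} [CompactSpace s] (f : C(s, ℂ))
    (g : ℂ → ℂ) (hfg : ∀ z : s, f z = g z) :
    f ∈ (polynomialFunctions s).topologicalClosure ↔ PolynomialApproximable s g := by
  rw [← SetLike.mem_coe, Subalgebra.topologicalClosure_coe, Metric.mem_closure_iff]
  refine forall₂_congr fun ε hε => ?_
  constructor
  · rintro ⟨_, ⟨P, -, rfl⟩, hP⟩
    refine ⟨P, fun z hz => ?_⟩
    have := (ContinuousMap.dist_lt_iff hε).1 hP ⟨z, hz⟩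
    rw [dist_comm, dist_eq_norm, hfg] at this
    simpa using this
  · rintro ⟨P, hP⟩
    refine ⟨P.toContinuousMapOn s, ⟨P, trivial, rfl⟩, ?_⟩
    rw [ContinuousMap.dist_lt_iff hε]
    intro z
    rw [dist_comm, dist_eq_norm, hfg]
    simpa using hP z z.2

/-- Neumann series in the uniform closure of the polynomials. -/
theorem exists_inverse_mem_closure_polynomialFunctions {s : Set ℂ} [CompactSpace s] {x : C(s, ℂ)}
    (hx : x ∈ (polynomialFunctions s).topologicalClosure) (h1 : ∀ z, ‖x z‖ < 1) :
    ∃ y ∈ (polynomialFunctions s).topologicalClosure, ∀ z, (1 - x z) * y z = 1 := by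
  have hn : ‖x‖ < 1 := (ContinuousMap.norm_lt_iff x one_pos).2 h1
  refine ⟨∑' n : ℕ, x ^ n, ?_, fun z => ?_⟩
  · have hsum := (summable_geometric_of_norm_lt_one hn).hasSum
    refine (Subalgebra.isClosed_topologicalClosure (polynomialFunctions s)).mem_of_tendsto hsum
      (Eventually.of_forall fun t => ?_)
    exact Subalgebra.sum_mem _ fun n _ => Subalgebra.pow_mem _ hx n
  · have := mul_neg_geom_series x hn
    exact congrArg (fun f : C(s, ℂ) => f z) this

/-- Pole pushing. -/
theorem PolynomialApproximable.inv_sub {s : Set ℂ} (hs : IsCompact s) {a b : ℂ}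
    (ha : PolynomialApproximable s fun z => (z - a)⁻¹) (h : ∀ z ∈ s, ‖b - a‖ < ‖z - a‖) :
    PolynomialApproximable s fun z => (z - b)⁻¹ := by
  have := isCompact_iff_compactSpace.1 hs
  have h0 : ∀ z : s, (z : ℂ) - a ≠ 0 := fun z =>
    norm_pos_iff.1 ((norm_nonneg _).trans_lt (h z z.2))
  let k : C(s, ℂ) := ⟨fun z => ((z : ℂ) - a)⁻¹,
    (continuous_subtype_val.sub continuous_const).inv₀ h0⟩
  have hk := (mem_closure_polynomialFunctions_iff k (fun z => (z - a)⁻¹) fun _ => rfl).2 ha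
  -- With `k = 1 / (z - a)`, one has `1 / (z - b) = k / (1 - (b - a) k)`, and `|(b - a) k| < 1` on
  -- `s`.
  obtain ⟨y, hy, hxy⟩ := exists_inverse_mem_closure_polynomialFunctions (x := (b - a) • k)
    (Subalgebra.smul_mem _ hk _) (fun z => by
      change ‖(b - a) * ((z : ℂ) - a)⁻¹‖ < 1
      rw [norm_mul, norm_inv, ← div_eq_mul_inv, div_lt_one (norm_pos_iff.2 (h0 z))]
      exact h z z.2)
  refine (mem_closure_polynomialFunctions_iff (k * y) _ fun z => ?_).1
    (Subalgebra.mul_mem _ hk hy)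
  have e : (1 - (b - a) * ((z : ℂ) - a)⁻¹) * y z = 1 := hxy z
  have e' : ((z : ℂ) - b) * (((z : ℂ) - a)⁻¹ * y z) = 1 := by
    rw [← e]
    field_simp [h0 z]
    ring
  change ((z : ℂ) - a)⁻¹ * y z = ((z : ℂ) - b)⁻¹
  exact (inv_eq_of_mul_eq_one_right e').symm

/-- Expansion of `-a⁻¹ / (1 - z / a)` in a geometric series; this is the starting point of pole
pushing, near infinity. -/
theorem polynomialApproximable_inv_sub_of_lt_norm {s : Set ℂ} (hs : IsCompact s) {a : ℂ}
    (h : ∀ z ∈ s, ‖z‖ < ‖a‖) : PolynomialApproximable s fun z => (z - a)⁻¹ := by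
  have := isCompact_iff_compactSpace.1 hs
  rcases s.eq_empty_or_nonempty with rfl | ⟨z₀, hz₀⟩
  · exact fun ε _ => ⟨0, by simp⟩
  have ha : 0 < ‖a‖ := (norm_nonneg _).trans_lt (h z₀ hz₀)
  have ha0 : a ≠ 0 := norm_pos_iff.1 ha
  let x : C(s, ℂ) := ⟨fun z => a⁻¹ * (z : ℂ), continuous_const.mul continuous_subtype_val⟩
  have hx := (mem_closure_polynomialFunctions_iff x (fun z => a⁻¹ * z) fun _ => rfl).2
    fun ε hε => ⟨C a⁻¹ * X, fun z _ => by simpa using hε⟩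
  obtain ⟨y, hy, hxy⟩ := exists_inverse_mem_closure_polynomialFunctions hx (fun z => by
      change ‖a⁻¹ * (z : ℂ)‖ < 1
      rw [norm_mul, norm_inv, inv_mul_lt_one₀ ha]
      exact h z z.2)
  refine (mem_closure_polynomialFunctions_iff ((-a⁻¹) • y) _ fun z => ?_).1
    (Subalgebra.smul_mem _ hy _)
  have e : (1 - a⁻¹ * (z : ℂ)) * y z = 1 := hxy z
  have e' : ((z : ℂ) - a) * (-a⁻¹ * y z) = 1 := by
    rw [← e]
    field_simp
    ring
  exact (inv_eq_of_mul_eq_one_right e').symm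

/-- The function `1 / (z - a)` is holomorphic and a uniform limit of polynomials on the closed
`δ`-neighbourhood of `K`. -/
def IsApproximablePole (K : Set ℂ) (δ : ℝ) (a : ℂ) : Prop :=
  a ∉ Metric.cthickening δ K ∧
    PolynomialApproximable (Metric.cthickening δ K) fun z => (z - a)⁻¹

theorem IsApproximablePole.mono {K : Set ℂ} {δ δ' : ℝ} {a : ℂ} (h : IsApproximablePole K δ a)
    (hδ : δ' ≤ δ) : IsApproximablePole K δ' a :=
  ⟨fun h' => h.1 (Metric.cthickening_mono hδ _ h'), h.2.mono (Metric.cthickening_mono hδ _)⟩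

/-- The poles `a` for which `1 / (z - a)` is a uniform limit of polynomials on a closed
neighbourhood of `K`. -/
def approximablePoles (K : Set ℂ) : Set ℂ := {a | ∃ δ > 0, IsApproximablePole K δ a}

theorem sub_le_norm_of_mem_cthickening {K : Set ℂ} (hK : IsCompact K) {δ r : ℝ} (hδ : 0 ≤ δ)
    {a z : ℂ} (hr : ∀ w ∈ K, r ≤ ‖w - a‖) (hz : z ∈ Metric.cthickening δ K) :
    r - δ ≤ ‖z - a‖ := by
  rw [hK.cthickening_eq_biUnion_closedBall hδ] at hz
  simp only [Set.mem_iUnion, Metric.mem_closedBall, dist_eq_norm, exists_prop] at hz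
  obtain ⟨w, hw, hzw⟩ := hz
  have h1 := hr w hw
  have h2 : ‖w - a‖ ≤ ‖z - a‖ + ‖z - w‖ := by
    simpa [norm_sub_rev a w] using norm_sub_le (z - a) (z - w)
  linarith

theorem IsApproximablePole.of_norm_sub_add_lt {K : Set ℂ} (hK : IsCompact K) {a b : ℂ} {r δ : ℝ}
    (ha : IsApproximablePole K δ a) (hδ : 0 ≤ δ) (hr : ∀ z ∈ K, r ≤ ‖z - a‖)
    (hb : ‖b - a‖ + δ < r) : IsApproximablePole K δ b := by
  have hlt : ∀ z ∈ Metric.cthickening δ K, ‖b - a‖ < ‖z - a‖ := by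
    intro z hz
    have h1 := sub_le_norm_of_mem_cthickening hK hδ hr hz
    linarith
  exact ⟨fun h => lt_irrefl _ (hlt b h), ha.2.inv_sub hK.cthickening hlt⟩

/-- The slack `r - ‖b - a‖` pays for the neighbourhood of `K`: its width is cut down to half of it.
-/
theorem mem_approximablePoles_of_norm_sub_lt {K : Set ℂ} (hK : IsCompact K) {a b : ℂ} {r : ℝ}
    (ha : a ∈ approximablePoles K) (hr : ∀ z ∈ K, r ≤ ‖z - a‖) (hb : ‖b - a‖ < r) :
    b ∈ approximablePoles K := by
  obtain ⟨δ, hδ, hap⟩ := ha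
  have hδ' : 0 < min δ ((r - ‖b - a‖) / 2) := lt_min hδ (by linarith)
  have h2 := min_le_right δ ((r - ‖b - a‖) / 2)
  exact ⟨_, hδ', (hap.mono (min_le_left _ _)).of_norm_sub_add_lt hK hδ'.le hr (by linarith)⟩

theorem mem_approximablePoles_of_lt_norm {K : Set ℂ} (hK : IsCompact K) {a : ℂ} {r : ℝ}
    (h : ∀ z ∈ K, ‖z‖ ≤ r) (ha : r < ‖a‖) : a ∈ approximablePoles K := by
  have hδ : 0 < (‖a‖ - r) / 2 := by linarith
  have hlt : ∀ z ∈ Metric.cthickening ((‖a‖ - r) / 2) K, ‖z‖ < ‖a‖ := by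
    intro z hz
    rw [hK.cthickening_eq_biUnion_closedBall hδ.le] at hz
    simp only [Set.mem_iUnion, Metric.mem_closedBall, dist_eq_norm, exists_prop] at hz
    obtain ⟨w, hw, hzw⟩ := hz
    have h1 := h w hw
    have h2 : ‖z‖ ≤ ‖z - w‖ + ‖w‖ := by simpa using norm_add_le (z - w) w
    linarith
  exact ⟨_, hδ, fun h => lt_irrefl _ (hlt a h),
    polynomialApproximable_inv_sub_of_lt_norm hK.cthickening hlt⟩

theorem exists_pos_forall_le_norm_sub {K : Set ℂ} (hK : IsCompact K) {a : ℂ} (ha : a ∉ K) :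
    ∃ r > 0, ∀ z ∈ K, r ≤ ‖z - a‖ := by
  obtain ⟨r, hr, h⟩ := Metric.isOpen_iff.1 hK.isClosed.isOpen_compl a ha
  refine ⟨r, hr, fun z hz => ?_⟩
  by_contra hlt
  exact h (by simpa [dist_eq_norm] using hlt) hz

theorem isOpen_approximablePoles {K : Set ℂ} (hK : IsCompact K) :
    IsOpen (approximablePoles K) := by
  rw [Metric.isOpen_iff]
  intro a ha
  have haK : a ∉ K := by
    obtain ⟨δ, hδ, h⟩ := ha
    exact fun h' => h.1 (Metric.self_subset_cthickening K h')
  obtain ⟨r, hr, h⟩ := exists_pos_forall_le_norm_sub hK haK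
  exact ⟨r, hr, fun b hb => mem_approximablePoles_of_norm_sub_lt hK ha h
    (by simpa [dist_eq_norm] using hb)⟩

/-- Pushing is reversible at short distance: an approximable pole within half the distance from `a`
to `K` could be pushed back to `a`. So the good poles are both open and closed in the complement of
`K`. -/
theorem isOpen_compl_diff_approximablePoles {K : Set ℂ} (hK : IsCompact K) :
    IsOpen (Kᶜ \ approximablePoles K) := by
  rw [Metric.isOpen_iff]
  rintro a ⟨haK, ha⟩
  obtain ⟨r, hr, h⟩ := exists_pos_forall_le_norm_sub hK haK
  refine ⟨r / 2, by linarith, fun b hb => ?_⟩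
  rw [Metric.mem_ball, dist_eq_norm] at hb
  have hrb : ∀ z ∈ K, r / 2 ≤ ‖z - b‖ := by
    intro z hz
    have h1 := h z hz
    have h2 : ‖z - a‖ ≤ ‖z - b‖ + ‖b - a‖ := by simpa using norm_add_le (z - b) (b - a)
    linarith
  refine ⟨fun hbK => ?_, fun hbG => ha ?_⟩
  · have := hrb b hbK
    rw [sub_self, norm_zero] at this
    linarith
  · exact mem_approximablePoles_of_norm_sub_lt hK hbG hrb (by rwa [norm_sub_rev])

/-- For compact sets of poles, the neighbourhood of `K` can be chosen uniformly. -/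
theorem exists_forall_isApproximablePole {K T : Set ℂ} (hK : IsCompact K) (hT : IsCompact T)
    (hKT : Disjoint K T) (h : T ⊆ approximablePoles K) :
    ∃ δ > 0, ∀ w ∈ T, IsApproximablePole K δ w := by
  refine hT.induction_on (p := fun T => ∃ δ > 0, ∀ w ∈ T, IsApproximablePole K δ w)
    ⟨1, one_pos, by simp⟩ ?_ ?_ ?_
  · rintro s t hst ⟨δ, hδ, h⟩
    exact ⟨δ, hδ, fun w hw => h w (hst hw)⟩
  · rintro s t ⟨δ, hδ, h⟩ ⟨δ', hδ', h'⟩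
    refine ⟨min δ δ', lt_min hδ hδ', ?_⟩
    rintro w (hw | hw)
    · exact (h w hw).mono (min_le_left _ _)
    · exact (h' w hw).mono (min_le_right _ _)
  · intro a ha
    obtain ⟨δ, hδ, hap⟩ := h ha
    obtain ⟨r, hr, hra⟩ := exists_pos_forall_le_norm_sub hK (Set.disjoint_right.1 hKT ha)
    refine ⟨Metric.ball a (r / 2), mem_nhdsWithin_of_mem_nhds (Metric.ball_mem_nhds _ (by linarith)),
      min δ (r / 4), lt_min hδ (by linarith), fun b hb => ?_⟩
    rw [Metric.mem_ball, dist_eq_norm] at hb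
    have h2 := min_le_right δ (r / 4)
    exact (hap.mono (min_le_left _ _)).of_norm_sub_add_lt hK (le_min hδ.le (by linarith)) hra
      (by linarith)

/-- If the complement of `S` in the Riemann sphere is connected, all poles off a bounded piece of
`S` can be pushed to infinity. -/
theorem mem_approximablePoles {S : Set ℂ} (hS : IsClosed S)
    (hconn : IsConnected (((↑) : ℂ → OnePoint ℂ) '' S)ᶜ) (R : ℝ) {a : ℂ}
    (ha : a ∉ S ∩ Metric.closedBall 0 R) :
    a ∈ approximablePoles (S ∩ Metric.closedBall 0 R) := by
  have hK : IsCompact (S ∩ Metric.closedBall 0 R) := (isCompact_closedBall 0 R).inter_left hS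
  have hbig : ∀ b : ℂ, R < ‖b‖ → b ∈ approximablePoles (S ∩ Metric.closedBall 0 R) := fun b hb =>
    mem_approximablePoles_of_lt_norm hK (fun z hz => by simpa using hz.2) hb
  set K := S ∩ Metric.closedBall 0 R
  -- Connectedness is known for the complement of `S`, not of `K`. The points of `S` outside `K`
  -- have modulus greater than `R` and are settled directly.
  by_cases haS : a ∈ S
  · refine hbig a (not_le.1 fun h => ha ⟨haS, by simpa using h⟩)
  by_contra hcon
  have hu : IsOpen (insert (OnePoint.infty) (((↑) : ℂ → OnePoint ℂ) '' approximablePoles K)) := by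
    rw [OnePoint.isOpen_iff_of_mem (by simp)]
    have e : ((↑) : ℂ → OnePoint ℂ) ⁻¹'
        (insert (OnePoint.infty) (((↑) : ℂ → OnePoint ℂ) '' approximablePoles K)) =
          approximablePoles K := by
      ext z
      simp
    rw [e]
    refine ⟨(isOpen_approximablePoles hK).isClosed_compl,
      (isCompact_closedBall (0 : ℂ) R).of_isClosed_subset
        (isOpen_approximablePoles hK).isClosed_compl fun z hz => ?_⟩
    by_contra h
    exact hz (hbig z (by simpa using h))
  have hv : IsOpen (((↑) : ℂ → OnePoint ℂ) '' (Kᶜ \ approximablePoles K)) :=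
    OnePoint.isOpenEmbedding_coe.isOpenMap _ (isOpen_compl_diff_approximablePoles hK)
  -- The good poles together with infinity, and the bad points off `K`, are disjoint open sets
  -- covering the complement of `S` in the sphere. The first contains infinity and the second would
  -- contain `a`.
  obtain ⟨x, -, hxu, hxv⟩ := hconn.isPreconnected _ _ hu hv (by
      intro x hx
      induction x using OnePoint.rec with
      | infty => exact Or.inl (by simp)
      | coe z =>
        by_cases hz : z ∈ approximablePoles K
        · exact Or.inl (Or.inr ⟨z, hz, rfl⟩)
        · exact Or.inr ⟨z, ⟨fun h => hx ⟨z, h.1, rfl⟩, hz⟩, rfl⟩)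
    ⟨OnePoint.infty, by simp, by simp⟩ ⟨a, by simpa using haS, ⟨a, ⟨ha, hcon⟩, rfl⟩⟩
  obtain ⟨z, hz, rfl⟩ := hxv
  exact hz.2 (by simpa using hxu)

/-! ### The Cauchy-Pompeiu formula -/

section

open MeasureTheory

/-- The function `2 i ∂φ/∂z̄`. -/
noncomputable def dbar (φ : ℂ → ℂ) (w : ℂ) : ℂ :=
  Complex.I * fderiv ℝ φ w 1 - fderiv ℝ φ w Complex.I

theorem dbar_eq_zero {φ : ℂ → ℂ} {w : ℂ} (h : DifferentiableAt ℂ φ w) : dbar φ w = 0 := by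
  rw [dbar, h.fderiv_restrictScalars ℝ]
  simp only [ContinuousLinearMap.coe_restrictScalars']
  have : fderiv ℂ φ w Complex.I = Complex.I * fderiv ℂ φ w 1 := by
    rw [← smul_eq_mul, ← map_smul, smul_eq_mul, mul_one]
  rw [this, sub_self]

theorem ContDiff.continuous_dbar {φ : ℂ → ℂ} (h : ContDiff ℝ 1 φ) : Continuous (dbar φ) := by
  have := h.continuous_fderiv one_ne_zero
  unfold dbar
  fun_prop

/-- The residue computation around a square. Opposite sides combine to a constant multiple of `1 /
(1 + (x / N) ^ 2)`, and the arctangent makes each pair contribute `π i`. -/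
theorem integral_inv_boundary_square {N : ℝ} (hN : 0 < N) :
    (∫ x : ℝ in -N..N, ((x : ℂ) + ((-N : ℝ) : ℂ) * Complex.I)⁻¹) -
      (∫ x : ℝ in -N..N, ((x : ℂ) + (N : ℂ) * Complex.I)⁻¹) +
      Complex.I • (∫ y : ℝ in -N..N, ((N : ℂ) + y * Complex.I)⁻¹) -
      Complex.I • ∫ y : ℝ in -N..N, (((-N : ℝ) : ℂ) + y * Complex.I)⁻¹ =
    2 * Real.pi * Complex.I := by
  have hne1 : ∀ (c : ℝ), c ≠ 0 → ∀ x : ℝ, (x : ℂ) + (c : ℂ) * Complex.I ≠ 0 := by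
    intro c hc x h
    exact hc (by simpa using congrArg Complex.im h)
  have hne2 : ∀ (c : ℝ), c ≠ 0 → ∀ x : ℝ, (c : ℂ) + (x : ℂ) * Complex.I ≠ 0 := by
    intro c hc x h
    exact hc (by simpa using congrArg Complex.re h)
  have hi1 : ∀ c : ℝ, c ≠ 0 → IntervalIntegrable
      (fun x : ℝ => ((x : ℂ) + (c : ℂ) * Complex.I)⁻¹) volume (-N) N := fun c hc =>
    (Continuous.inv₀ (by fun_prop) (hne1 c hc)).intervalIntegrable _ _
  have hi2 : ∀ c : ℝ, c ≠ 0 → IntervalIntegrable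
      (fun x : ℝ => ((c : ℂ) + (x : ℂ) * Complex.I)⁻¹) volume (-N) N := fun c hc =>
    (Continuous.inv₀ (by fun_prop) (hne2 c hc)).intervalIntegrable _ _
  have hN' : -N ≠ 0 := neg_ne_zero.2 hN.ne'
  rw [add_sub_assoc, ← smul_sub, ← intervalIntegral.integral_sub (hi1 _ hN') (hi1 _ hN.ne'),
    ← intervalIntegral.integral_sub (hi2 _ hN.ne') (hi2 _ hN')]
  have hNC : (N : ℂ) ≠ 0 := by exact_mod_cast hN.ne'
  have hfac : ∀ x : ℝ, (1 + ((x / N : ℝ) : ℂ) ^ 2) =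
      ((x : ℂ) + (N : ℂ) * Complex.I) * ((x : ℂ) + ((-N : ℝ) : ℂ) * Complex.I) / N ^ 2 := by
    intro x
    push_cast
    field_simp
    ring_nf
    rw [Complex.I_sq]
    ring
  have hfac' : ∀ x : ℝ, (1 + ((x / N : ℝ) : ℂ) ^ 2) =
      -(((N : ℂ) + x * Complex.I) * (((-N : ℝ) : ℂ) + x * Complex.I)) / N ^ 2 := by
    intro x
    push_cast
    field_simp
    ring_nf
    rw [Complex.I_sq]
    ring
  have e1 : ∀ x : ℝ, ((x : ℂ) + ((-N : ℝ) : ℂ) * Complex.I)⁻¹ - ((x : ℂ) + (N : ℂ) * Complex.I)⁻¹ =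
      (2 * Complex.I / N) * (((1 + (x / N) ^ 2)⁻¹ : ℝ) : ℂ) := by
    intro x
    have h1 := hne1 _ hN' x
    have h2 := hne1 _ hN.ne' x
    rw [Complex.ofReal_inv, Complex.ofReal_add, Complex.ofReal_one, Complex.ofReal_pow, hfac,
      inv_sub_inv h1 h2, inv_div]
    have e : ((x : ℂ) + (N : ℂ) * Complex.I) - ((x : ℂ) + ((-N : ℝ) : ℂ) * Complex.I) = 2 * N * Complex.I := by
      push_cast
      ring
    rw [e]
    field_simp
  have e2 : ∀ x : ℝ, ((N : ℂ) + x * Complex.I)⁻¹ - (((-N : ℝ) : ℂ) + x * Complex.I)⁻¹ =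
      (2 / N) * (((1 + (x / N) ^ 2)⁻¹ : ℝ) : ℂ) := by
    intro x
    have h1 := hne2 _ hN' x
    have h2 := hne2 _ hN.ne' x
    rw [Complex.ofReal_inv, Complex.ofReal_add, Complex.ofReal_one, Complex.ofReal_pow, hfac',
      inv_sub_inv h2 h1, inv_div]
    have e : (((-N : ℝ) : ℂ) + x * Complex.I) - ((N : ℂ) + x * Complex.I) = -(2 * N) := by
      push_cast
      ring
    rw [e]
    field_simp
  simp_rw [e1, e2]
  rw [intervalIntegral.integral_const_mul, intervalIntegral.integral_const_mul,
    intervalIntegral.integral_ofReal,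
    intervalIntegral.integral_comp_div (fun x => (1 + x ^ 2)⁻¹) hN.ne', integral_inv_one_add_sq,
    neg_div, div_self hN.ne', Real.arctan_neg, Real.arctan_one]
  simp only [smul_eq_mul]
  push_cast
  field_simp
  ring

theorem integral_rect_eq_integral {h : ℂ → ℂ} (hc : Continuous h) {M N : ℝ} (hMN : M < N)
    (hM : ∀ w, M < ‖w‖ → h w = 0) :
    ∫ x : ℝ in -N..N, ∫ y : ℝ in -N..N, h (x + y * Complex.I) = ∫ w, h w := by
  have hsupp : HasCompactSupport h :=
    HasCompactSupport.intro (isCompact_closedBall (0 : ℂ) M) fun w hw => hM w (by simpa using hw)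
  have hint : Integrable h := hc.integrable_of_hasCompactSupport hsupp
  have h1 : ∀ x y : ℝ, h (x + y * Complex.I) ≠ 0 → |x| ≤ M ∧ |y| ≤ M := by
    intro x y hne
    have hle : ‖(x : ℂ) + y * Complex.I‖ ≤ M := not_lt.1 fun h' => hne (hM _ h')
    constructor
    · have := Complex.abs_re_le_norm ((x : ℂ) + y * Complex.I)
      simp only [Complex.add_re, Complex.ofReal_re, Complex.re_ofReal_mul, Complex.I_re,
        mul_zero, add_zero] at this
      linarith
    · have := Complex.abs_im_le_norm ((x : ℂ) + y * Complex.I)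
      simp only [Complex.add_im, Complex.ofReal_im, Complex.im_ofReal_mul, Complex.I_im,
        mul_one, zero_add] at this
      linarith
  have h2 : ∀ x : ℝ, ∫ y : ℝ in -N..N, h (x + y * Complex.I) = ∫ y : ℝ, h (x + y * Complex.I) := by
    intro x
    refine intervalIntegral.integral_eq_integral_of_support_subset fun y hy => ?_
    have := abs_le.1 (h1 x y hy).2
    exact ⟨by linarith, by linarith⟩
  simp_rw [h2]
  rw [intervalIntegral.integral_eq_integral_of_support_subset]
  · have hmp := Complex.volume_preserving_equiv_real_prod.symm
    have e : ∀ p : ℝ × ℝ, Complex.measurableEquivRealProd.symm p = p.1 + p.2 * Complex.I := by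
      intro p
      rw [Complex.measurableEquivRealProd_symm_apply, Complex.mk_eq_add_mul_I]
    rw [← hmp.integral_comp (MeasurableEquiv.measurableEmbedding _) h]
    have hint' := (hmp.integrable_comp_emb (MeasurableEquiv.measurableEmbedding _)).2 hint
    simp only [Function.comp_def, e] at hint' ⊢
    exact (integral_prod _ hint').symm
  · intro x hx
    obtain ⟨y, hy⟩ : ∃ y : ℝ, h (x + y * Complex.I) ≠ 0 := by
      by_contra hcon
      push Not at hcon
      exact hx (by simp [hcon])
    have := abs_le.1 (h1 x y hy).1
    exact ⟨by linarith, by linarith⟩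

/-- The Cauchy-Pompeiu formula at the origin, for a function that is holomorphic near it. -/
theorem integral_inv_mul_dbar {φ : ℂ → ℂ} (hφ : ContDiff ℝ 1 φ) (hs : HasCompactSupport φ)
    (h0 : ∀ᶠ w in 𝓝 0, DifferentiableAt ℂ φ w) :
    ∫ w, w⁻¹ * dbar φ w = -(2 * Real.pi * Complex.I * φ 0) := by
  obtain ⟨M, hM0, hM⟩ : ∃ M > 0, tsupport φ ⊆ Metric.closedBall 0 M := by
    obtain ⟨M, hM⟩ := hs.isBounded.subset_closedBall 0
    exact ⟨max M 1, lt_max_of_lt_right one_pos,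
      hM.trans (Metric.closedBall_subset_closedBall (le_max_left _ _))⟩
  have hφ0 : ∀ w, M < ‖w‖ → φ w = 0 := fun w hw =>
    image_eq_zero_of_notMem_tsupport fun h => not_le.2 hw (by simpa using hM h)
  have hd0 : ∀ w, M < ‖w‖ → dbar φ w = 0 := by
    intro w hw
    have : φ =ᶠ[𝓝 w] fun _ => 0 :=
      (notMem_tsupport_iff_eventuallyEq).1 fun h => not_le.2 hw (by simpa using hM h)
    rw [dbar, this.fderiv_eq]
    simp
  have hcont : Continuous fun w => w⁻¹ * dbar φ w := by
    rw [continuous_iff_continuousAt]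
    intro w
    rcases eq_or_ne w 0 with rfl | hw
    · have : (fun w => w⁻¹ * dbar φ w) =ᶠ[𝓝 0] fun _ => 0 := by
        filter_upwards [h0] with w hw
        rw [dbar_eq_zero hw, mul_zero]
      exact continuousAt_const.congr this.symm
    · exact (continuousAt_inv₀ hw).mul hφ.continuous_dbar.continuousAt
  have hN : 0 < M + 1 := by linarith
  have hrect := integral_rect_eq_integral hcont (lt_add_one M) fun w hw => by
    rw [hd0 w hw, mul_zero]
  set N := M + 1 with hNM
  -- The real derivative, off the origin, of `(φ w - φ 0) / w`. Subtracting `φ 0` makes the quotient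
  -- continuous at `0`; the second term is complex linear and so drops out of the `∂/∂z̄`
  -- combination.
  let f' : ℂ → ℂ →L[ℝ] ℂ := fun w => w⁻¹ • fderiv ℝ φ w -
    ((φ w - φ 0) * (w⁻¹) ^ 2) • (ContinuousLinearMap.id ℝ ℂ)
  have hf' : ∀ w, Complex.I • f' w 1 - f' w Complex.I = w⁻¹ * dbar φ w := by
    intro w
    simp only [f', dbar, _root_.sub_apply, _root_.smul_apply,
      ContinuousLinearMap.id_apply, smul_eq_mul]
    ring
  have key := Complex.integral_boundary_rect_of_hasFDerivAt_real_off_countable (dslope φ 0) f'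
    ⟨-N, -N⟩ ⟨N, N⟩ {0} (Set.countable_singleton 0) (by
      refine Continuous.continuousOn ?_
      rw [continuous_iff_continuousAt]
      intro w
      rcases eq_or_ne w 0 with rfl | hw
      · exact continuousAt_dslope_same.2 h0.self_of_nhds
      · exact (continuousAt_dslope_of_ne hw).2 hφ.continuous.continuousAt) (by
      rintro w ⟨-, hw⟩
      have hw : w ≠ 0 := hw
      have hslope : dslope φ 0 =ᶠ[𝓝 w] fun w => w⁻¹ * (φ w - φ 0) := by
        filter_upwards [isOpen_ne.mem_nhds hw] with v hv
        rw [dslope_of_ne _ hv, slope_def_field, sub_zero, div_eq_inv_mul]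
      refine HasFDerivAt.congr_of_eventuallyEq ?_ hslope
      have h1 : HasFDerivAt (𝕜 := ℝ) (fun w : ℂ => w⁻¹)
          (-(w⁻¹ ^ 2) • ContinuousLinearMap.id ℝ ℂ) w := by
        refine ((hasDerivAt_inv hw).hasFDerivAt.restrictScalars ℝ).congr_fderiv ?_
        ext v
        simp [mul_comm]
      have h2 := ((hφ.differentiable one_ne_zero) w).hasFDerivAt.sub_const (φ 0)
      refine (h1.mul h2).congr_fderiv ?_
      ext v; simp [f']; ring) (by
      simp only [hf']
      exact hcont.continuousOn.integrableOn_compact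
        (isCompact_uIcc.reProdIm isCompact_uIcc))
  simp only [hf'] at key
  rw [hrect] at key
  -- On the boundary of the square `φ` vanishes, so only the subtracted constant survives there.
  have hb : ∀ w : ℂ, M < ‖w‖ → dslope φ 0 w = -φ 0 * w⁻¹ := by
    intro w hw
    have : w ≠ 0 := norm_pos_iff.1 (hM0.trans hw)
    rw [dslope_of_ne _ this, slope_def_field, sub_zero, hφ0 w hw, zero_sub, div_eq_mul_inv]
  have hre : ∀ (c : ℝ), |c| = N → ∀ y : ℝ, M < ‖(c : ℂ) + y * Complex.I‖ := by
    intro c hc y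
    have := Complex.abs_re_le_norm ((c : ℂ) + y * Complex.I)
    simp only [Complex.add_re, Complex.ofReal_re, Complex.re_ofReal_mul, Complex.I_re,
        mul_zero, add_zero] at this
    linarith
  have him : ∀ (c : ℝ), |c| = N → ∀ x : ℝ, M < ‖(x : ℂ) + c * Complex.I‖ := by
    intro c hc x
    have := Complex.abs_im_le_norm ((x : ℂ) + c * Complex.I)
    simp only [Complex.add_im, Complex.ofReal_im, Complex.im_ofReal_mul, Complex.I_im,
        mul_one, zero_add] at this
    linarith
  have hN1 : |N| = N := abs_of_pos hN
  have hN2 : |-N| = N := by rw [abs_neg, hN1]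
  simp only [hb _ (hre _ hN1 _), hb _ (hre _ hN2 _), hb _ (him _ hN1 _), hb _ (him _ hN2 _),
    intervalIntegral.integral_const_mul] at key
  rw [← key]
  have := integral_inv_boundary_square hN
  simp only [smul_eq_mul] at this ⊢
  linear_combination (-φ 0) * this

/-- The Cauchy-Pompeiu formula, for a function that is holomorphic near the point. -/
theorem integral_dbar_mul_inv_sub {φ : ℂ → ℂ} (hφ : ContDiff ℝ 1 φ) (hs : HasCompactSupport φ)
    {z : ℂ} (hz : ∀ᶠ w in 𝓝 z, DifferentiableAt ℂ φ w) :
    φ z = ∫ w, (2 * Real.pi * Complex.I)⁻¹ * dbar φ w * (z - w)⁻¹ := by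
  have h1 : ContDiff ℝ 1 fun w => φ (w + z) := hφ.comp (contDiff_id.add contDiff_const)
  have h2 : HasCompactSupport fun w => φ (w + z) := hs.comp_homeomorph (Homeomorph.addRight z)
  have h3 : ∀ᶠ w in 𝓝 (0 : ℂ), DifferentiableAt ℂ (fun w => φ (w + z)) w := by
    have ht : Tendsto (fun w : ℂ => w + z) (𝓝 0) (𝓝 z) := by
      have : Continuous fun w : ℂ => w + z := by fun_prop
      simpa using this.tendsto 0
    filter_upwards [ht.eventually hz] with w hw
    exact differentiableAt_comp_add_const.2 hw
  have key := integral_inv_mul_dbar h1 h2 h3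
  have e : ∀ w, dbar (fun w => φ (w + z)) w = dbar φ (w + z) := by
    intro w
    rw [dbar, fderiv_comp_add_right, dbar]
  simp only [e, zero_add] at key
  have hI := integral_add_right_eq_self (μ := volume) (fun w => (w - z)⁻¹ * dbar φ w) z
  simp only [add_sub_cancel_right] at hI
  rw [hI] at key
  simp_rw [mul_assoc]
  rw [integral_const_mul]
  have e2 : (∫ w, dbar φ w * (z - w)⁻¹) = -∫ w, (w - z)⁻¹ * dbar φ w := by
    rw [← integral_neg]
    congr 1
    funext w
    rw [← neg_sub w z, inv_neg]
    ring
  rw [e2, key]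
  have hpi : (Real.pi : ℂ) ≠ 0 := by exact_mod_cast Real.pi_ne_zero
  field_simp [Complex.I_ne_zero]

end

/-! ### Runge's theorem with derivatives -/

section

open MeasureTheory

/-- A smooth cutoff function. -/
theorem exists_contDiff_cutoff {K t : Set ℂ} (hK : IsClosed K) (ht : K ⊆ interior t) :
    ∃ χ : ℂ → ℝ, ContDiff ℝ 1 χ ∧ (∀ᶠ x in 𝓝ˢ K, χ x = 1) ∧ ∀ x ∉ t, χ x = 0 := by
  obtain ⟨f, h1, h0, -⟩ := exists_contMDiffMap_one_nhds_of_subset_interior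
    (modelWithCornersSelf ℝ ℂ) (n := 1) hK ht
  exact ⟨f, f.contMDiff.contDiff, h1, h0⟩

/-- A holomorphic function near a compact set `K` is a superposition of functions `1 / (z - w)`
with poles `w` off a neighbourhood of `K`. -/
theorem exists_integral_representation {K U : Set ℂ} (hK : IsCompact K) (hU : IsOpen U)
    (hKU : K ⊆ U) {F : ℂ → ℂ} (hF : DifferentiableOn ℂ F U) :
    ∃ (T V : Set ℂ) (g : ℂ → ℂ), IsCompact T ∧ IsOpen V ∧ K ⊆ V ∧ Disjoint V T ∧ Continuous g ∧
      ∀ z ∈ V, F z = ∫ w in T, g w * (z - w)⁻¹ := by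
  obtain ⟨δ, hδ, hδU⟩ := hK.exists_cthickening_subset_open hU hKU
  set t := Metric.cthickening δ K
  have htc : IsCompact t := hK.cthickening
  have hKt : K ⊆ interior t := (Metric.self_subset_thickening hδ K).trans
    (interior_maximal (Metric.thickening_subset_cthickening δ K) Metric.isOpen_thickening)
  obtain ⟨χ, hχ, h1, h0⟩ := exists_contDiff_cutoff hK.isClosed hKt
  obtain ⟨V, hVo, hKV, hV⟩ := mem_nhdsSet_iff_exists.1 h1
  let φ : ℂ → ℂ := fun w => (χ w : ℂ) * F w
  have hφt : ∀ w ∉ t, φ =ᶠ[𝓝 w] fun _ => 0 := by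
    intro w hw
    filter_upwards [htc.isClosed.isOpen_compl.mem_nhds hw] with v hv
    simp [φ, h0 v hv]
  have hφ : ContDiff ℝ 1 φ := by
    rw [contDiff_iff_contDiffAt]
    intro w
    by_cases hw : w ∈ t
    · have hFw : ContDiffAt ℝ 1 F w :=
        ((hF.contDiffOn hU).contDiffAt (hU.mem_nhds (hδU hw))).restrict_scalars ℝ
      exact (Complex.ofRealCLM.contDiff.contDiffAt.comp w hχ.contDiffAt).mul hFw
    · exact contDiffAt_const.congr_of_eventuallyEq (hφt w hw)
  have hs : HasCompactSupport φ :=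
    HasCompactSupport.intro htc fun w hw => (hφt w hw).self_of_nhds
  have hφV : ∀ w ∈ V ∩ U, φ =ᶠ[𝓝 w] F := by
    intro w hw
    filter_upwards [hVo.mem_nhds hw.1] with v hv
    have : χ v = 1 := hV hv
    simp [φ, this]
  have hd : ∀ w ∈ V ∩ U, DifferentiableAt ℂ φ w := fun w hw =>
    ((hF.differentiableAt (hU.mem_nhds hw.2))).congr_of_eventuallyEq (hφV w hw)
  have hVU : IsOpen (V ∩ U) := hVo.inter hU
  -- The density `dbar φ` lives on this set only: off `t` the function `φ` is locally zero, and on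
  -- `V ∩ U` it agrees locally with the holomorphic `F`.
  refine ⟨t \ (V ∩ U), V ∩ U, fun w => (2 * Real.pi * Complex.I)⁻¹ * dbar φ w, htc.diff hVU,
    hVU, Set.subset_inter hKV hKU, Set.disjoint_sdiff_right,
    continuous_const.mul hφ.continuous_dbar, fun z hz => ?_⟩
  rw [← (hφV z hz).self_of_nhds, integral_dbar_mul_inv_sub hφ hs
    (by filter_upwards [hVU.mem_nhds hz] with w hw using hd w hw)]
  refine (setIntegral_eq_integral_of_forall_compl_eq_zero fun w hw => ?_).symm
  have : dbar φ w = 0 := by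
    by_cases hwt : w ∈ t
    · exact dbar_eq_zero (hd w (by_contra fun h => hw ⟨hwt, h⟩))
    · rw [dbar, (hφt w hwt).fderiv_eq]
      simp
  rw [this, mul_zero, zero_mul]

/-- An integral of uniformly approximable functions is approximable. -/
theorem polynomialApproximable_integral {s T : Set ℂ} (hs : IsCompact s) (hT : IsCompact T)
    {g : ℂ → ℂ} (hg : Continuous g) (hd : ∀ w ∈ T, w ∉ s)
    (h : ∀ w ∈ T, PolynomialApproximable s fun z => (z - w)⁻¹) :
    PolynomialApproximable s fun z => ∫ w in T, g w * (z - w)⁻¹ := by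
  have := isCompact_iff_compactSpace.1 hs
  have := isCompact_iff_compactSpace.1 hT
  let k : C(T × s, ℂ) := ⟨fun x => g x.1 * ((x.2 : ℂ) - x.1)⁻¹, by
    refine (hg.comp (by fun_prop)).mul (Continuous.inv₀ (by fun_prop) fun x hx => ?_)
    exact hd x.1 x.1.2 (by rw [← sub_eq_zero.1 hx]; exact x.2.2)⟩
  have hk : ∀ w : T, k.curry w ∈ (polynomialFunctions s).topologicalClosure := by
    intro w
    let r : C(s, ℂ) := ⟨fun z => ((z : ℂ) - w)⁻¹, Continuous.inv₀ (by fun_prop) fun z hz =>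
      hd w w.2 (by rw [← sub_eq_zero.1 hz]; exact z.2)⟩
    have hr : r ∈ (polynomialFunctions s).topologicalClosure :=
      (mem_closure_polynomialFunctions_iff r _ fun _ => rfl).2 (h w w.2)
    exact Subalgebra.smul_mem _ hr (g w)
  -- The uniform closure of the polynomials is a Banach space, so the Bochner integral of `w ↦ g w /
  -- (· - w)` can be formed inside it; evaluation at a point commutes with that integral.
  let M : Submodule ℂ C(s, ℂ) := Subalgebra.toSubmodule (polynomialFunctions s).topologicalClosure
  have hM : IsClosed (M : Set C(s, ℂ)) := Subalgebra.isClosed_topologicalClosure _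
  have : CompleteSpace M := hM.completeSpace_coe
  let G : T → M := fun w => ⟨k.curry w, hk w⟩
  have hG : Continuous G := k.curry.continuous.subtype_mk _
  let μ : Measure T := Measure.comap Subtype.val volume
  have : IsFiniteMeasure μ := ⟨by
    rw [comap_subtype_coe_apply hT.measurableSet, Set.image_univ, Subtype.range_coe]
    exact hT.measure_lt_top⟩
  have hGi : Integrable G μ := hG.integrable_of_hasCompactSupport (HasCompactSupport.of_compactSpace G)
  refine (mem_closure_polynomialFunctions_iff (M.subtypeL (∫ w, G w ∂μ)) _ fun z => ?_).1
    (∫ w, G w ∂μ).2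
  let L : M →L[ℂ] ℂ := (ContinuousMap.evalCLM ℂ z).comp M.subtypeL
  have e := L.integral_comp_comm hGi
  change L (∫ w, G w ∂μ) = _
  rw [← e, ← integral_subtype_comap hT.measurableSet]
  rfl

/-- The poles of the integral representation fill a compact set disjoint from `K`, so one
neighbourhood of `K` serves all of them. -/
theorem exists_polynomialApproximable {K U : Set ℂ} (hK : IsCompact K)
    (hpoles : Kᶜ ⊆ approximablePoles K) (hU : IsOpen U) (hKU : K ⊆ U) {F : ℂ → ℂ}
    (hF : DifferentiableOn ℂ F U) :
    ∃ δ > 0, Metric.cthickening δ K ⊆ U ∧ PolynomialApproximable (Metric.cthickening δ K) F := by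
  obtain ⟨T, V, g, hT, hV, hKV, hVT, hg, hFg⟩ := exists_integral_representation hK hU hKU hF
  obtain ⟨δ₁, hδ₁, h₁⟩ := hK.exists_cthickening_subset_open (hV.inter hU)
    (Set.subset_inter hKV hKU)
  have hKT : Disjoint K T := hVT.mono_left hKV
  obtain ⟨δ₂, hδ₂, h₂⟩ := exists_forall_isApproximablePole hK hT hKT
    fun w hw => hpoles (Set.disjoint_right.1 hKT hw)
  have h₃ : Metric.cthickening (min δ₁ δ₂) K ⊆ V ∩ U :=
    (Metric.cthickening_mono (min_le_left _ _) _).trans h₁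
  refine ⟨min δ₁ δ₂, lt_min hδ₁ hδ₂, h₃.trans Set.inter_subset_right, ?_⟩
  have key := polynomialApproximable_integral (s := Metric.cthickening (min δ₁ δ₂) K)
    hK.cthickening hT hg (fun w hw => ((h₂ w hw).mono (min_le_right _ _)).1)
    fun w hw => ((h₂ w hw).mono (min_le_right _ _)).2
  intro ε hε
  obtain ⟨P, hP⟩ := key ε hε
  refine ⟨P, fun z hz => ?_⟩
  rw [hFg z (h₃ hz).1]
  exact hP z hz

theorem iteratedDeriv_polynomial_eval (P : ℂ[X]) (l : ℕ) :
    iteratedDeriv l (fun z => P.eval z) = fun z => (derivative^[l] P).eval z := by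
  induction l with
  | zero => simp
  | succ l ih =>
    rw [iteratedDeriv_succ, ih, Function.iterate_succ_apply']
    funext z
    exact Polynomial.deriv _

/-- **Runge's theorem** on bounded pieces of a closed set with connected complement in the sphere,
with approximation of finitely many derivatives. -/
theorem runge_iteratedDeriv {S U : Set ℂ} (hS : IsClosed S)
    (hconn : IsConnected (((↑) : ℂ → OnePoint ℂ) '' S)ᶜ) (hU : IsOpen U) (hSU : S ⊆ U)
    {F : ℂ → ℂ} (hF : DifferentiableOn ℂ F U) (R : ℝ) (n : ℕ) {ε : ℝ} (hε : 0 < ε) :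
    ∃ P : ℂ[X], ∀ l ≤ n, ∀ z ∈ S, ‖z‖ ≤ R →
      ‖(derivative^[l] P).eval z - iteratedDeriv l F z‖ < ε := by
  have hK : IsCompact (S ∩ Metric.closedBall 0 R) := (isCompact_closedBall 0 R).inter_left hS
  obtain ⟨δ, hδ, hδU, hap⟩ := exists_polynomialApproximable hK
    (fun a ha => mem_approximablePoles hS hconn R ha) hU (Set.inter_subset_left.trans hSU) hF
  -- `B` dominates the constants `l! / δ ^ l` in Cauchy's estimates for all `l ≤ n`; `B + 1` leaves
  -- room for a strict inequality.
  set B := ∑ l ∈ Finset.range (n + 1), (l.factorial : ℝ) / δ ^ l with hB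
  have hterm : ∀ l, 0 ≤ (l.factorial : ℝ) / δ ^ l := fun l => by positivity
  have hB0 : 0 ≤ B := Finset.sum_nonneg fun l _ => hterm l
  obtain ⟨P, hP⟩ := hap (ε / (B + 1)) (by positivity)
  refine ⟨P, fun l hl z hz hzR => ?_⟩
  have hzK : z ∈ S ∩ Metric.closedBall 0 R := ⟨hz, by simpa using hzR⟩
  have hball : Metric.closedBall z δ ⊆ Metric.cthickening δ (S ∩ Metric.closedBall 0 R) :=
    Metric.closedBall_subset_cthickening hzK δ
  have hdiff : DifferentiableOn ℂ (fun w => P.eval w - F w) U :=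
    P.differentiable.differentiableOn.sub hF
  have hc := Complex.norm_iteratedDeriv_le_of_forall_mem_sphere_norm_le (c := z) (R := δ)
    (f := fun w => P.eval w - F w) (C := ε / (B + 1)) l hδ
    ((hdiff.mono (hball.trans hδU)).diffContOnCl_ball subset_rfl)
    fun w hw => (hP w (hball (Metric.sphere_subset_closedBall hw))).le
  have hzU : z ∈ U := hSU hz
  rw [iteratedDeriv_fun_sub P.differentiable.contDiff.contDiffAt
    ((hF.contDiffOn hU).contDiffAt (hU.mem_nhds hzU)), iteratedDeriv_polynomial_eval] at hc
  refine hc.trans_lt ?_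
  have hle : (l.factorial : ℝ) / δ ^ l ≤ B :=
    Finset.single_le_sum (f := fun l : ℕ => (l.factorial : ℝ) / δ ^ l) (fun l _ => hterm l)
      (Finset.mem_range.2 (Nat.lt_succ_of_le hl))
  calc (l.factorial : ℝ) * (ε / (B + 1)) / δ ^ l = (l.factorial : ℝ) / δ ^ l * (ε / (B + 1)) := by
        ring
    _ ≤ B * (ε / (B + 1)) := by gcongr
    _ < ε := by
        rw [← mul_div_assoc, div_lt_iff₀ (by linarith)]
        nlinarith

end

/-! ### Continuous dependence of Padé numerators and denominators -/

/-- A family of polynomials of bounded degree whose coefficients depend continuously on the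
parameter. -/
def ContinuousFamily {T : Type*} [TopologicalSpace T] (P : T → ℂ[X]) : Prop :=
  (∀ k, Continuous fun t => (P t).coeff k) ∧ ∃ d, ∀ t, (P t).natDegree ≤ d

namespace ContinuousFamily

variable {T : Type*} [TopologicalSpace T] {P Q : T → ℂ[X]}

theorem mul (hP : ContinuousFamily P) (hQ : ContinuousFamily Q) :
    ContinuousFamily fun t => P t * Q t := by
  obtain ⟨hP, d, hd⟩ := hP
  obtain ⟨hQ, e, he⟩ := hQ
  refine ⟨fun k => ?_, d + e, fun t => natDegree_mul_le.trans (add_le_add (hd t) (he t))⟩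
  simp only [coeff_mul]
  exact continuous_finsetSum _ fun x _ => (hP _).mul (hQ _)

theorem sub (hP : ContinuousFamily P) (hQ : ContinuousFamily Q) :
    ContinuousFamily fun t => P t - Q t := by
  obtain ⟨hP, d, hd⟩ := hP
  obtain ⟨hQ, e, he⟩ := hQ
  refine ⟨fun k => ?_, max d e, fun t => (natDegree_sub_le _ _).trans (max_le_max (hd t) (he t))⟩
  simp only [coeff_sub]
  exact (hP _).sub (hQ _)

theorem const (R : ℂ[X]) : ContinuousFamily fun _ : T => R :=
  ⟨fun _ => continuous_const, R.natDegree, fun _ => le_rfl⟩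

theorem derivative (hP : ContinuousFamily P) : ContinuousFamily fun t => (P t).derivative := by
  obtain ⟨hP, d, hd⟩ := hP
  refine ⟨fun k => ?_, d, fun t => (natDegree_derivative_le _).trans ((Nat.sub_le _ _).trans (hd t))⟩
  simp only [coeff_derivative]
  exact (hP _).mul continuous_const

theorem eval (hP : ContinuousFamily P) {g : T → ℂ} (hg : Continuous g) :
    Continuous fun t => (P t).eval (g t) := by
  obtain ⟨hP, d, hd⟩ := hP
  have e : ∀ t, (P t).eval (g t) = ∑ i ∈ Finset.range (d + 1), (P t).coeff i * g t ^ i := fun t =>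
    eval_eq_sum_range' (Nat.lt_succ_of_le (hd t)) _
  simp only [e]
  exact continuous_finsetSum _ fun i _ => (hP i).mul (hg.pow i)

end ContinuousFamily

/-- The numerator of the `l`-th derivative of `N / D` over the denominator `D ^ (l + 1)`. -/
noncomputable def derivNumerator (N D : ℂ[X]) : ℕ → ℂ[X]
  | 0 => N
  | l + 1 => derivative (derivNumerator N D l) * D -
      C (l + 1 : ℂ) * (derivNumerator N D l * derivative D)

theorem iteratedDeriv_eval_div_eval (N D : ℂ[X]) (l : ℕ) (x : ℂ) (hx : D.eval x ≠ 0) :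
    iteratedDeriv l (fun z => N.eval z / D.eval z) x =
      (derivNumerator N D l).eval x / D.eval x ^ (l + 1) := by
  induction l generalizing x with
  | zero => simp [derivNumerator]
  | succ l ih =>
    have hev : iteratedDeriv l (fun z => N.eval z / D.eval z) =ᶠ[𝓝 x]
        fun z => (derivNumerator N D l).eval z / D.eval z ^ (l + 1) := by
      filter_upwards [D.continuous.continuousAt.eventually_ne hx] with z hz using ih z hz
    rw [iteratedDeriv_succ, hev.deriv_eq]
    have h1 := (derivNumerator N D l).hasDerivAt x
    have h2 := (D.hasDerivAt x).fun_pow (l + 1)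
    rw [(h1.fun_div h2 (pow_ne_zero _ hx)).deriv]
    simp only [derivNumerator, eval_sub, eval_mul, eval_C]
    rw [div_eq_div_iff (by positivity) (by positivity)]
    push_cast
    ring

theorem ContinuousFamily.derivNumerator {T : Type*} [TopologicalSpace T] {N D : T → ℂ[X]}
    (hN : ContinuousFamily N) (hD : ContinuousFamily D) (l : ℕ) :
    ContinuousFamily fun t => derivNumerator (N t) (D t) l := by
  induction l with
  | zero => exact hN
  | succ l ih => exact (ih.derivative.mul hD).sub ((const _).mul (ih.mul hD.derivative))

section PadeFamily

variable {T : Type*} [TopologicalSpace T] {a : T → ℕ → ℂ}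

theorem continuous_hankelMatrix (ha : ∀ v, Continuous fun t => a t v) (p q : ℕ) :
    Continuous fun t => hankelMatrix (a t) p q := by
  refine continuous_matrix fun i j => ?_
  simp only [hankelMatrix, Matrix.of_apply]
  split_ifs
  · exact ha _
  · exact continuous_const

theorem continuous_hankelDet (ha : ∀ v, Continuous fun t => a t v) (p q : ℕ) :
    Continuous fun t => hankelDet (a t) p q :=
  (continuous_hankelMatrix ha p q).matrix_det

/-- The use of the adjugate instead of the inverse gives continuity even at parameters where the
Hankel determinant vanishes. -/
theorem continuousFamily_padeDenom (ha : ∀ v, Continuous fun t => a t v) (p q : ℕ) :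
    ContinuousFamily fun t => padeDenom (a t) p q := by
  refine ⟨fun k => ?_, q, fun t => padeDenom_natDegree_le _ _ _⟩
  have hadj : Continuous fun t => (hankelMatrix (a t) p q).adjugate.mulVec
      fun i : Fin q => -a t (p + 1 + i) :=
    (continuous_hankelMatrix ha p q).matrix_adjugate.matrix_mulVec
      (continuous_pi fun i => (ha _).neg)
  simp only [padeDenom, coeff_add, finsetSum_coeff, coeff_C_mul, coeff_C]
  refine Continuous.add ?_ (continuous_finsetSum _ fun j _ =>
    ((continuous_apply j).comp hadj).mul continuous_const)
  split_ifs
  · exact continuous_hankelDet ha p q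
  · exact continuous_const

theorem continuousFamily_padeNum (ha : ∀ v, Continuous fun t => a t v) (p q : ℕ) :
    ContinuousFamily fun t => padeNum (a t) p q := by
  refine ⟨fun k => ?_, p, fun t => padeNum_natDegree_le _ _ _⟩
  simp only [padeNum, PowerSeries.coeff_trunc]
  split_ifs
  · simp only [PowerSeries.coeff_mul, Polynomial.coeff_coe, PowerSeries.coeff_mk]
    exact continuous_finsetSum _ fun x _ => ((continuousFamily_padeDenom ha p q).1 _).mul (ha _)
  · exact continuous_const

end PadeFamily

/-! ### Completeness of the function space and density of polynomials -/

theorem DifferentiableOn.iteratedDeriv_of_isOpen {F : ℂ → ℂ} {U : Set ℂ}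
    (hF : DifferentiableOn ℂ F U) (hU : IsOpen U) (l : ℕ) :
    DifferentiableOn ℂ (iteratedDeriv l F) U := by
  induction l with
  | zero => simpa using hF
  | succ l ih =>
    rw [iteratedDeriv_succ]
    exact ih.deriv hU

theorem tendstoLocallyUniformlyOn_iteratedDeriv {U : Set ℂ} (hU : IsOpen U) {F : ℕ → ℂ → ℂ}
    {G : ℂ → ℂ} (hF : ∀ k, DifferentiableOn ℂ (F k) U)
    (h : TendstoLocallyUniformlyOn F G atTop U) (l : ℕ) :
    TendstoLocallyUniformlyOn (fun k => iteratedDeriv l (F k)) (iteratedDeriv l G) atTop U := by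
  induction l with
  | zero => simpa using h
  | succ l ih =>
    have := ih.deriv (Eventually.of_forall fun k => (hF k).iteratedDeriv_of_isOpen hU l) hU
    rw [iteratedDeriv_succ]
    convert this using 2 with k
    rw [Function.comp, iteratedDeriv_succ]

/-- Local compactness makes evaluation jointly continuous; with σ-compactness, the compact-open
topology is completely metrizable. -/
instance locallyCompactSpace_closure (Ω : Set ℂ) : LocallyCompactSpace (closure Ω) :=
  isClosed_closure.isClosedEmbedding_subtypeVal.locallyCompactSpace

instance sigmaCompactSpace_closure (Ω : Set ℂ) : SigmaCompactSpace (closure Ω) :=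
  isClosed_closure.isClosedEmbedding_subtypeVal.sigmaCompactSpace

/-- Locally uniform limits of derivative sequences are derivative sequences. -/
theorem isClosed_isDerivativeSequence {Ω : Set ℂ} (hΩ : IsOpen Ω) :
    IsClosed {f : ℕ → C(closure Ω, ℂ) | IsDerivativeSequence Ω f} := by
  refine IsSeqClosed.isClosed fun u f hu hf => ?_
  choose F hF hFu using hu
  rw [tendsto_pi_nhds] at hf
  -- The value `0` off the closure is irrelevant: derivatives are taken only at points of the open
  -- set `Ω`.
  let G : ℂ → ℂ := Function.extend Subtype.val (f 0) 0
  have hG : ∀ z : closure Ω, G z = f 0 z := fun z => Subtype.val_injective.extend_apply _ _ _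
  have hlim : TendstoLocallyUniformlyOn F G atTop Ω := by
    rw [tendstoLocallyUniformlyOn_iff_forall_isCompact hΩ]
    intro K hK hKc
    have h0 := ContinuousMap.tendsto_iff_forall_isCompact_tendstoUniformlyOn.1 (hf 0)
      (Subtype.val ⁻¹' K) (isClosed_closure.isClosedEmbedding_subtypeVal.isCompact_preimage hKc)
    rw [Metric.tendstoUniformlyOn_iff] at h0 ⊢
    intro ε hε
    filter_upwards [h0 ε hε] with k hk z hz
    have := hk ⟨z, subset_closure (hK hz)⟩ hz
    rwa [hFu k 0 ⟨z, subset_closure (hK hz)⟩ (hK hz), ← hG, iteratedDeriv_zero] at this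
  refine ⟨G, hlim.differentiableOn (Eventually.of_forall hF) hΩ, fun l z hz => ?_⟩
  have h1 := (tendstoLocallyUniformlyOn_iteratedDeriv hΩ hF hlim l).tendsto_at hz
  have h2 : Tendsto (fun k => u k l z) atTop (𝓝 (f l z)) :=
    ((ContinuousEvalConst.continuous_eval_const z).tendsto _).comp (hf l)
  simp only [hFu _ l z hz] at h2
  exact tendsto_nhds_unique h2 h1

/-- A closed subset of a closed subset of a countable product of completely metrizable spaces. -/
theorem baireSpace_XInfty {Ω : Set ℂ} (hΩ : IsOpen Ω) : BaireSpace (XInfty Ω) := by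
  have h1 : IsClosedEmbedding (Subtype.val : AInfty Ω → ℕ → C(closure Ω, ℂ)) :=
    (isClosed_isDerivativeSequence hΩ).isClosedEmbedding_subtypeVal
  have h2 : IsClosedEmbedding (Subtype.val : XInfty Ω → AInfty Ω) :=
    isClosed_closure.isClosedEmbedding_subtypeVal
  have := (h1.comp h2).IsCompletelyMetrizableSpace
  infer_instance

/-- The element of `A^∞(Ω)` given by a function holomorphic near the closure of `Ω`. -/
noncomputable def AInfty.ofHolomorphic {Ω U : Set ℂ} (hU : IsOpen U) (hΩU : closure Ω ⊆ U)
    {F : ℂ → ℂ} (hF : DifferentiableOn ℂ F U) : AInfty Ω :=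
  ⟨fun l => ⟨fun z => iteratedDeriv l F z, by
    exact (hF.iteratedDeriv_of_isOpen hU l).continuousOn.comp_continuous continuous_subtype_val fun z => hΩU z.2⟩,
    F, hF.mono (subset_closure.trans hΩU), fun _ _ _ => rfl⟩

/-- The element of `A^∞(Ω)` given by a polynomial. -/
noncomputable def AInfty.ofPolynomial (Ω : Set ℂ) (P : ℂ[X]) : AInfty Ω :=
  ⟨fun l => ⟨fun z => (derivative^[l] P).eval (z : ℂ), by fun_prop⟩,
    fun z => P.eval z, P.differentiable.differentiableOn, fun l z _ => by
      rw [iteratedDeriv_polynomial_eval]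
      rfl⟩

theorem AInfty.derivExt_ofPolynomial (Ω : Set ℂ) (P : ℂ[X]) (l : ℕ) (z : closure Ω) :
    (AInfty.ofPolynomial Ω P).derivExt l z = (derivative^[l] P).eval (z : ℂ) := rfl

theorem AInfty.ofPolynomial_mem_XInfty (Ω : Set ℂ) (P : ℂ[X]) :
    AInfty.ofPolynomial Ω P ∈ XInfty Ω :=
  subset_closure ⟨Set.univ, fun z => P.eval z, isOpen_univ, Set.subset_univ _,
    P.differentiable.differentiableOn, fun _ => rfl⟩

/-- If the complement of the closure of `Ω` in the sphere is connected, the polynomials are dense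
in `X^∞`. -/
theorem XInfty_subset_closure_range_ofPolynomial {Ω : Set ℂ} (hΩ : IsOpen Ω)
    (hconn : IsConnected (((↑) : ℂ → OnePoint ℂ) '' closure Ω)ᶜ) :
    XInfty Ω ⊆ closure (Set.range (AInfty.ofPolynomial Ω)) := by
  refine closure_minimal ?_ isClosed_closure
  rintro f ⟨U, F, hU, hΩU, hF, hfF⟩
  obtain rfl : f = AInfty.ofHolomorphic hU hΩU hF :=
    AInfty.ext_on hΩ _ _ fun z _ => by
      rw [hfF]
      simp [AInfty.derivExt, AInfty.ofHolomorphic]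
  -- The index `n` is at once the radius, the order of the derivatives and, through `1 / (n + 1)`,
  -- the precision.
  choose P hP using fun n : ℕ => runge_iteratedDeriv isClosed_closure hconn hU hΩU hF n n
    (Nat.one_div_pos_of_nat (α := ℝ) (n := n))
  refine mem_closure_of_tendsto (f := fun n => AInfty.ofPolynomial Ω (P n)) (b := atTop) ?_
    (Eventually.of_forall fun n => ⟨P n, rfl⟩)
  refine tendsto_subtype_rng.2 (tendsto_pi_nhds.2 ?_)
  intro l
  rw [ContinuousMap.tendsto_iff_forall_isCompact_tendstoUniformlyOn]
  intro K hK
  obtain ⟨R, hR⟩ := (hK.image continuous_subtype_val).isBounded.exists_norm_le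
  rw [Metric.tendstoUniformlyOn_iff]
  intro ε hε
  filter_upwards [eventually_ge_atTop l, eventually_ge_atTop ⌈R⌉₊,
    tendsto_one_div_add_atTop_nhds_zero_nat.eventually (gt_mem_nhds hε)] with n hn hnR hnε z hz
  rw [dist_comm, dist_eq_norm]
  refine lt_trans ?_ hnε
  exact hP n l hn z z.2 ((hR z ⟨z, hz, rfl⟩).trans ((Nat.le_ceil R).trans (by exact_mod_cast hnR)))

/-! ### Good approximation at one level as an open condition -/

section PadeClose

variable {Ω : Set ℂ}

theorem AInfty.continuous_derivExt (l : ℕ) :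
    Continuous fun x : AInfty Ω × closure Ω => x.1.derivExt l x.2 := by
  have h : Continuous fun x : AInfty Ω × closure Ω => x.1.1 l :=
    (continuous_apply l).comp (continuous_subtype_val.comp continuous_fst)
  exact h.eval continuous_snd

theorem AInfty.continuous_taylorCoeff (v : ℕ) :
    Continuous fun x : AInfty Ω × closure Ω => x.1.taylorCoeff x.2 v :=
  (AInfty.continuous_derivExt v).div_const _

/-- At the centre `ζ` and the point `z`, the `[p/q]` Padé approximant of `f` is regular and its
derivatives up to the order `n` are closer than `1 / (n + 1)` to those of `f`. -/
def AInfty.IsPadeClose (n p q : ℕ) (f : AInfty Ω) (ζ z : closure Ω) : Prop :=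
  hankelDet (f.taylorCoeff ζ) p q ≠ 0 ∧ ¬ f.HasPadePole p q ζ z ∧
    ∀ l ∈ Finset.range (n + 1),
      ‖iteratedDeriv l (f.padeAt p q ζ) z - f.derivExt l z‖ < 1 / ((n : ℝ) + 1)

theorem AInfty.iteratedDeriv_padeAt {f : AInfty Ω} {p q : ℕ} {ζ : closure Ω}
    (h : hankelDet (f.taylorCoeff ζ) p q ≠ 0) (l : ℕ) {z : ℂ}
    (hz : (padeDenom (f.taylorCoeff ζ) p q).eval (z - ζ) ≠ 0) :
    iteratedDeriv l (f.padeAt p q ζ) z =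
      (derivNumerator (padeNum (f.taylorCoeff ζ) p q) (padeDenom (f.taylorCoeff ζ) p q) l).eval
        (z - ζ) / (padeDenom (f.taylorCoeff ζ) p q).eval (z - ζ) ^ (l + 1) := by
  have e : f.padeAt p q ζ = fun z => (fun x => (padeNum (f.taylorCoeff ζ) p q).eval x /
      (padeDenom (f.taylorCoeff ζ) p q).eval x) (z - ζ) :=
    funext fun z => padeApproximant_eval h _
  rw [e]
  refine (congrFun (iteratedDeriv_comp_sub_const l (fun x => (padeNum (f.taylorCoeff ζ) p q).eval x /
    (padeDenom (f.taylorCoeff ζ) p q).eval x) (ζ : ℂ)) z).trans ?_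
  exact iteratedDeriv_eval_div_eval _ _ l _ hz

/-- Clearing denominators removes the rational function, whose definition involves choice, and
leaves strict inequalities between quantities that are continuous everywhere. -/
theorem AInfty.isPadeClose_iff (n p q : ℕ) (f : AInfty Ω) (ζ z : closure Ω) :
    f.IsPadeClose n p q ζ z ↔ hankelDet (f.taylorCoeff ζ) p q ≠ 0 ∧
      (padeDenom (f.taylorCoeff ζ) p q).eval ((z : ℂ) - ζ) ≠ 0 ∧
      ∀ l ∈ Finset.range (n + 1),
        ‖(derivNumerator (padeNum (f.taylorCoeff ζ) p q) (padeDenom (f.taylorCoeff ζ) p q) l).eval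
          ((z : ℂ) - ζ) - f.derivExt l z *
            (padeDenom (f.taylorCoeff ζ) p q).eval ((z : ℂ) - ζ) ^ (l + 1)‖ <
          1 / ((n : ℝ) + 1) *
            ‖(padeDenom (f.taylorCoeff ζ) p q).eval ((z : ℂ) - ζ) ^ (l + 1)‖ := by
  refine and_congr_right fun h => and_congr
    (not_congr (padeApproximant_denom_eval_eq_zero_iff h _)) Iff.rfl |>.trans
    (and_congr_right fun hz => forall₂_congr fun l _ => ?_)
  have hp := pow_ne_zero (l + 1) hz
  rw [AInfty.iteratedDeriv_padeAt h l hz, div_sub' hp, norm_div, div_lt_iff₀ (norm_pos_iff.2 hp),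
    mul_comm (f.derivExt l z)]

theorem AInfty.isOpen_isPadeClose (n p q : ℕ) :
    IsOpen {x : AInfty Ω × (closure Ω × closure Ω) | x.1.IsPadeClose n p q x.2.1 x.2.2} := by
  have ha : ∀ v, Continuous fun x : AInfty Ω × (closure Ω × closure Ω) =>
      x.1.taylorCoeff x.2.1 v := fun v =>
    (AInfty.continuous_taylorCoeff v).comp
      (continuous_fst.prodMk (continuous_fst.comp continuous_snd))
  have hN := continuousFamily_padeNum ha p q
  have hD := continuousFamily_padeDenom ha p q
  have hg : Continuous fun x : AInfty Ω × (closure Ω × closure Ω) => (x.2.2 : ℂ) - x.2.1 := by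
    fun_prop
  have hf : ∀ l, Continuous fun x : AInfty Ω × (closure Ω × closure Ω) =>
      x.1.derivExt l x.2.2 := fun l => (AInfty.continuous_derivExt l).comp
        (continuous_fst.prodMk (continuous_snd.comp continuous_snd))
  simp only [AInfty.isPadeClose_iff, Set.ofPred_and, Set.ofPred_forall]
  refine (isOpen_ne_fun (continuous_hankelDet ha p q) continuous_const).inter
    ((isOpen_ne_fun (hD.eval hg) continuous_const).inter
      (isOpen_biInter_finset fun l _ => isOpen_lt ?_ ?_))
  · exact (((hN.derivNumerator hD l).eval hg).sub ((hf l).mul ((hD.eval hg).pow _))).norm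
  · exact continuous_const.mul ((hD.eval hg).pow _).norm

/-- The bounded pieces of the closure of `Ω`. -/
def closureBall (Ω : Set ℂ) (n : ℕ) : Set (closure Ω) := {z | ‖(z : ℂ)‖ ≤ n}

theorem isCompact_closureBall (n : ℕ) : IsCompact (closureBall Ω n) := by
  have h := isClosed_closure.isClosedEmbedding_subtypeVal.isCompact_preimage
    (isCompact_closedBall (0 : ℂ) n) (f := (Subtype.val : closure Ω → ℂ))
  convert h using 1
  ext z
  simp [closureBall]

theorem exists_subset_closureBall {K : Set (closure Ω)} (hK : IsCompact K) :
    ∃ n₀ : ℕ, ∀ n ≥ n₀, K ⊆ closureBall Ω n := by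
  obtain ⟨R, hR⟩ := (hK.image continuous_subtype_val).isBounded.exists_norm_le
  refine ⟨⌈R⌉₊, fun n hn z hz => ?_⟩
  exact (hR z ⟨z, hz, rfl⟩).trans ((Nat.le_ceil R).trans (by exact_mod_cast hn))

/-- The tube lemma over the compact set `K × K`. -/
theorem AInfty.isOpen_forall_isPadeClose (n p q : ℕ) {K : Set (closure Ω)} (hK : IsCompact K) :
    IsOpen {f : AInfty Ω | ∀ ζ ∈ K, ∀ z ∈ K, f.IsPadeClose n p q ζ z} := by
  rw [isOpen_iff_mem_nhds]
  intro f hf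
  have := (hK.prod hK).eventually_forall_of_forall_eventually (x₀ := f)
    (P := fun f x => f.IsPadeClose n p q x.1 x.2) fun x hx =>
      (AInfty.isOpen_isPadeClose n p q).mem_nhds (hf x.1 hx.1 x.2 hx.2)
  filter_upwards [this] with g hg ζ hζ z hz using hg (ζ, z) ⟨hζ, hz⟩

/-- Each level asks for finitely many derivatives on one compact set, so a late term of the sequence
achieves it. Conversely, one pair chosen per level forms the sequence, since every compact set lies
in `closureBall Ω n` for large `n`. -/
theorem hasPadeApproximation_iff (𝓕 : Set (ℕ × ℕ)) (f : AInfty Ω) :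
    HasPadeApproximation 𝓕 f ↔ ∀ n : ℕ, ∃ s ∈ 𝓕, ∀ ζ ∈ closureBall Ω n, ∀ z ∈ closureBall Ω n,
      f.IsPadeClose n s.1 s.2 ζ z := by
  constructor
  · rintro ⟨p, q, hpq, h⟩ n
    obtain ⟨⟨n₀, hn₀⟩, hl⟩ := h (closureBall Ω n) (isCompact_closureBall n)
    have hl' : ∀ᶠ m in atTop, ∀ l ∈ Finset.range (n + 1),
        ∀ x ∈ closureBall Ω n ×ˢ closureBall Ω n,
          dist (f.derivExt l x.2) (iteratedDeriv l (f.padeAt (p m) (q m) x.1) x.2) <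
            1 / ((n : ℝ) + 1) :=
      (Finset.range (n + 1)).eventually_all.2 fun l _ =>
        Metric.tendstoUniformlyOn_iff.1 (hl l) _ Nat.one_div_pos_of_nat
    obtain ⟨m, hm, hmn⟩ := (hl'.and (eventually_ge_atTop n₀)).exists
    refine ⟨(p m, q m), hpq m, fun ζ hζ z hz => ?_⟩
    obtain ⟨h1, -, h3⟩ := hn₀ m hmn ζ hζ
    refine ⟨h1, h3 z hz, fun l hln => ?_⟩
    rw [← dist_eq_norm, dist_comm]
    exact hm l hln (ζ, z) ⟨hζ, hz⟩
  · intro h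
    choose s hs h using h
    refine ⟨fun n => (s n).1, fun n => (s n).2, hs, fun K hK => ?_⟩
    obtain ⟨n₀, hn₀⟩ := exists_subset_closureBall hK
    refine ⟨⟨n₀, fun n hn ζ hζ => ?_⟩, fun l => ?_⟩
    · have h1 := (h n ζ (hn₀ n hn hζ) ζ (hn₀ n hn hζ)).1
      exact ⟨h1, existsUnique_isPadeApproximant h1, fun z hz =>
        (h n ζ (hn₀ n hn hζ) z (hn₀ n hn hz)).2.1⟩
    · rw [Metric.tendstoUniformlyOn_iff]
      intro ε hε
      filter_upwards [eventually_ge_atTop n₀, eventually_ge_atTop l,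
        tendsto_one_div_add_atTop_nhds_zero_nat.eventually (gt_mem_nhds hε)] with n hn hln hnε x hx
      rw [dist_comm, dist_eq_norm]
      exact ((h n x.1 (hn₀ n hn hx.1) x.2 (hn₀ n hn hx.2)).2.2 l
        (Finset.mem_range.2 (Nat.lt_succ_of_le hln))).trans hnε

/-! ### Polynomials and their perturbation to a prescribed degree -/

theorem AInfty.taylorCoeff_ofPolynomial (P : ℂ[X]) (ζ : closure Ω) (v : ℕ) :
    (AInfty.ofPolynomial Ω P).taylorCoeff ζ v = (taylor (ζ : ℂ) P).coeff v := by
  rw [AInfty.taylorCoeff, AInfty.derivExt_ofPolynomial, taylor_coeff, ← factorial_smul_hasseDeriv]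
  have : (v.factorial : ℂ) ≠ 0 := by exact_mod_cast v.factorial_ne_zero
  rw [div_eq_iff this]
  simp [mul_comm]

/-- A polynomial of exact degree `p` is its own `[p/q]` Padé approximant at every centre. -/
theorem AInfty.isPadeClose_ofPolynomial {P : ℂ[X]} (hP : P ≠ 0) (n q : ℕ) (ζ z : closure Ω) :
    (AInfty.ofPolynomial Ω P).IsPadeClose n P.natDegree q ζ z := by
  have ha : (AInfty.ofPolynomial Ω P).taylorCoeff ζ = (taylor (ζ : ℂ) P).coeff :=
    funext fun v => AInfty.taylorCoeff_ofPolynomial P ζ v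
  have hdeg : (taylor (ζ : ℂ) P).natDegree = P.natDegree := natDegree_taylor P _
  have hdet : hankelDet (taylor (ζ : ℂ) P).coeff P.natDegree q ≠ 0 := by
    refine hankelDet_ne_zero_of_vanish q ?_ fun v hv => coeff_eq_zero_of_natDegree_lt (by omega)
    rw [← hdeg]
    exact leadingCoeff_ne_zero.2 fun h => hP ((taylor_eq_zero _ _).1 h)
  have hpade : padeApproximant (taylor (ζ : ℂ) P).coeff P.natDegree q =
      algebraMap ℂ[X] (RatFunc ℂ) (taylor (ζ : ℂ) P) := by
    refine padeApproximant_eq hdet ⟨taylor (ζ : ℂ) P, 1, hdeg.le, by simp, by simp, by simp, ?_⟩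
    intro v _
    simp
  have hat : (AInfty.ofPolynomial Ω P).padeAt P.natDegree q ζ = fun z => P.eval z := by
    funext w
    rw [AInfty.padeAt, ha, hpade, RatFunc.eval_algebraMap]
    simp [taylor_eval]
  refine ⟨by rwa [ha], ?_, fun l _ => ?_⟩
  · rw [AInfty.HasPadePole, ha, hpade, RatFunc.denom_algebraMap]
    simp
  · rw [hat, iteratedDeriv_polynomial_eval, AInfty.derivExt_ofPolynomial, sub_self, norm_zero]
    exact Nat.one_div_pos_of_nat

theorem AInfty.continuous_ofPolynomial_add_C_mul (P Q : ℂ[X]) :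
    Continuous fun c : ℂ => AInfty.ofPolynomial Ω (P + C c * Q) := by
  refine Continuous.subtype_mk (continuous_pi fun l => ?_) _
  refine ContinuousMap.continuous_of_continuous_uncurry _ ?_
  change Continuous fun x : ℂ × closure Ω => (derivative^[l] (P + C x.1 * Q)).eval (x.2 : ℂ)
  simp only [iterate_map_add, iterate_derivative_C_mul, eval_add, eval_mul, eval_C]
  fun_prop

/-- Every polynomial is a limit of polynomials of the exact degree `p`, for large `p`. -/
theorem ofPolynomial_mem_closure {𝓕 : Set (ℕ × ℕ)}
    (h𝓕 : ∃ s : ℕ → ℕ × ℕ, (∀ n, s n ∈ 𝓕) ∧ Tendsto (fun n => (s n).1) atTop atTop)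
    (P : ℂ[X]) (n : ℕ) (K : Set (closure Ω)) :
    AInfty.ofPolynomial Ω P ∈ closure {f : AInfty Ω | f ∈ XInfty Ω ∧
      ∃ s ∈ 𝓕, ∀ ζ ∈ K, ∀ z ∈ K, f.IsPadeClose n s.1 s.2 ζ z} := by
  obtain ⟨s, hs, hlim⟩ := h𝓕
  obtain ⟨m, hm⟩ := (hlim.eventually_gt_atTop P.natDegree).exists
  -- The limit `c → 0` is taken along `c ≠ 0`, where the degree is exactly `(s m).1`.
  have ht := ((AInfty.continuous_ofPolynomial_add_C_mul (Ω := Ω) P (X ^ (s m).1)).tendsto 0).mono_left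
    (nhdsWithin_le_nhds (s := {0}ᶜ))
  rw [C_0, zero_mul, add_zero] at ht
  refine mem_closure_of_tendsto ht ?_
  filter_upwards [self_mem_nhdsWithin] with c hc
  have hc : c ≠ 0 := hc
  have hd : (P + C c * X ^ (s m).1).natDegree = (s m).1 := by
    rw [natDegree_add_eq_right_of_natDegree_lt (by rwa [natDegree_C_mul_X_pow _ _ hc]),
      natDegree_C_mul_X_pow _ _ hc]
  have h0 : P + C c * X ^ (s m).1 ≠ 0 := by
    intro h
    rw [h, natDegree_zero] at hd
    omega
  refine ⟨AInfty.ofPolynomial_mem_XInfty Ω _, s m, hs m, fun ζ _ z _ => ?_⟩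
  have := AInfty.isPadeClose_ofPolynomial h0 n (s m).2 ζ z
  rwa [hd] at this

end PadeClose

/-! ### Conclusion by Baire's theorem -/

theorem theorem4p7 (Ω : Set ℂ) (hΩ : IsOpen Ω)
    (hconn : IsConnected (((↑) : ℂ → OnePoint ℂ) '' closure Ω)ᶜ)
    (𝓕 : Set (ℕ × ℕ))
    (h𝓕 : ∃ s : ℕ → ℕ × ℕ, (∀ n, s n ∈ 𝓕) ∧ Tendsto (fun n => (s n).1) atTop atTop) :
    IsGδ {f : XInfty Ω | HasPadeApproximation 𝓕 (f : AInfty Ω)} ∧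
      Dense {f : XInfty Ω | HasPadeApproximation 𝓕 (f : AInfty Ω)} := by
  let E : ℕ → Set (AInfty Ω) := fun n => {f | ∃ s ∈ 𝓕, ∀ ζ ∈ closureBall Ω n,
    ∀ z ∈ closureBall Ω n, f.IsPadeClose n s.1 s.2 ζ z}
  have heq : {f : XInfty Ω | HasPadeApproximation 𝓕 (f : AInfty Ω)} =
      ⋂ n, Subtype.val ⁻¹' E n := by
    ext f
    simp only [Set.mem_ofPred_eq, hasPadeApproximation_iff, Set.mem_iInter, Set.mem_preimage, E]
  have hE : ∀ n, IsOpen (E n) := by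
    intro n
    have e : E n = ⋃ s ∈ 𝓕, {f : AInfty Ω | ∀ ζ ∈ closureBall Ω n, ∀ z ∈ closureBall Ω n,
        f.IsPadeClose n s.1 s.2 ζ z} := by
      ext f
      simp [E]
    rw [e]
    exact isOpen_biUnion fun s _ =>
      AInfty.isOpen_forall_isPadeClose n s.1 s.2 (isCompact_closureBall n)
  have hopen : ∀ n, IsOpen (Subtype.val ⁻¹' E n : Set (XInfty Ω)) := fun n =>
    (hE n).preimage continuous_subtype_val
  have hdense : ∀ n, Dense (Subtype.val ⁻¹' E n : Set (XInfty Ω)) := by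
    intro n f
    -- Density in the subspace means that `f` is a limit of points of `E n` lying in `X^∞`; hence
    -- the approximating polynomials must be known to belong to `X^∞`.
    rw [closure_subtype, Subtype.image_preimage_coe]
    refine closure_minimal ?_ isClosed_closure
      (XInfty_subset_closure_range_ofPolynomial hΩ hconn f.2)
    rintro _ ⟨P, rfl⟩
    exact ofPolynomial_mem_closure h𝓕 P n (closureBall Ω n)
  have := baireSpace_XInfty hΩ
  rw [heq]
  exact ⟨IsGδ.iInter fun n => (hopen n).isGδ, dense_iInter_of_isOpen hopen hdense⟩
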